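/- Let $d\geq 1$, $H\in(1/2,1)$, and let $(\Omega,\mathcal A,\mathbb P)$ be the canonical probability space of the $d$-dimensional two-sided fractional Brownian motion $B$ of Hurst index $H$: $\Omega$ is the set of continuous $\omega:\mathbb R\to\mathbb R^d$ with $\omega(0)=0$, $\mathcal A$ is generated by the coordinate maps, $B(t,\omega)=\omega(t)$, and under $\mathbb P$ the process $B=(B_1,\dots,B_d)$ is centred Gaussian with $\mathbb E(B_i(s)B_j(t))=\tfrac12\mathbf 1_{i=j}(|s|^{2H}+|t|^{2H}-|t-s|^{2H})$. Let $\theta_t\omega:=\omega(t+\cdot)-\omega(t)$ for $t\in\mathbb R$ (Wiener shift). Let $A\in\mathcal M_d(\mathbb R)$, $S(t):=e^{tA}$, and let $b:\mathbb R\times\mathbb R^d\to\mathbb R^d$ and $\sigma:\mathbb R\to\mathcal M_d(\mathbb R)$ be continuous. Let $\|\cdot\|$ be the Euclidean norm and $\|\cdot\|_{\rm op}$ the associated operator norm. Assume that there are constants $c_S,m_S,c_b,m_b,\tau>0$ such that: 1. $\|S(t)\|_{\rm op}\leq c_S e^{-m_S t}$ for every $t\in\mathbb R$; 2. $\|b(t,x)-b(t,y)\|\leq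 c_b\|x-y\|$ and $\|b(t,x)\|\leq m_b(1+\|x\|)$ for all $t\in\mathbb R$, $x,y\in\mathbb R^d$; 3. for every $t\in\mathbb R$, each entry $h$ of the matrix function $s\mapsto S(t-s)\sigma(s)\mathbf 1_{]-\infty,t]}(s)$ satisfies $H(2H-1)\int_{\mathbb R}\int_{\mathbb R}|u-v|^{2H-2}|h(u)||h(v)|\,du\,dv<\infty$; 4. $b(\cdot,x)$, for every $x\in\mathbb R^d$, and $\sigma$ are $\tau$-periodic. A solution of $$dX(t)=(AX(t)+b(t,X(t)))\,dt+\sigma(t)\,dB(t),\qquad t\in\mathbb R,$$ is an $\mathbb R^d$-valued process $X$ such that, for every $t\in\mathbb R$, almost surely, $$X(t)=\int_{-\infty}^tS(t-s)b(s,X(s))\,ds+\int_{-\infty}^tS(t-s)\sigma(s)\,dB(s),$$ where the first integral is taken path by path and is absolutely convergent. Here the scalar Wiener integral on a compact interval is the $\mathbb L^2$ limit of the Riemann sums $\sum_k h(t_k)(B_j(t_{k+1})-B_j(t_k))$ as the mesh tends to $0$; matrix integrands are treated componentwise, $(\int_s^t h\,dB)_i=\sum_j\int_s^t h_{ij}\,dB_j$;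 and $\int_{-\infty}^t$ is the $\mathbb L^2$ limit of $\int_{-r}^t$ as $r\to\infty$. A process $X$ is uniformly bounded if $\sup_{t\in\mathbb R}\mathbb E\|X(t)\|^2<\infty$, and $\theta$-$\tau$-periodic if, for every $t\in\mathbb R$, $X(t+\tau,\theta_{-\tau}\omega)=X(t,\omega)$ for $\mathbb P$-almost every $\omega$. If $c_Sc_b/m_S<1$, then the equation has a uniformly bounded, $\theta$-$\tau$-periodic solution $X$ with continuous sample paths. It is unique up to modification, even among solutions continuous only in probability: if $Y$ is a jointly measurable process, continuous in probability, uniformly bounded, $\theta$-$\tau$-periodic and a solution, then $Y(t)=X(t)$ almost surely for every $t\in\mathbb R$. -/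

import Mathlib

open MeasureTheory ProbabilityTheory Filter Set
open scoped Topology ENNReal

noncomputable section

/-! ### The canonical probability space and the Wiener shift -/

/-- The canonical path space: continuous functions from `ℝ` to `ℝ^d` vanishing at `0`. -/
def FBmPath (d : ℕ) : Type :=
  {ω : C(ℝ, EuclideanSpace ℝ (Fin d)) // ω 0 = 0}

/-- The coordinate process `B(t, ω) = ω(t)` on the canonical space. -/
def coordProcess {d : ℕ} (t : ℝ) (ω : FBmPath d) : EuclideanSpace ℝ (Fin d) :=
  ω.1 t

/-- The σ-algebra generated by the coordinate maps (it is the Borel σ-algebra of the topology of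
locally uniform convergence). -/
instance FBmPath.instMeasurableSpace (d : ℕ) : MeasurableSpace (FBmPath d) :=
  MeasurableSpace.comap (fun ω t => coordProcess t ω) MeasurableSpace.pi

/-- The Wiener shift `θ_t ω = ω(t + ·) - ω(t)`. -/
def wienerShift {d : ℕ} (t : ℝ) (ω : FBmPath d) : FBmPath d :=
  ⟨⟨fun u => ω.1 (t + u) - ω.1 t, by fun_prop⟩, by simp⟩

/-- `P` is the law, on the canonical path space, of the `d`-dimensional two-sided fractional
Brownian motion with Hurst index `H`: the coordinate process is a centred Gaussian process whose
components are uncorrelated (hence independent), each with covariance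
`(|s|^{2H} + |t|^{2H} - |t - s|^{2H}) / 2`. -/
structure IsFBmLaw {d : ℕ} (H : ℝ) (P : Measure (FBmPath d)) : Prop where
  gaussian : IsGaussianProcess
    (fun (p : ℝ × Fin d) (ω : FBmPath d) => coordProcess p.1 ω p.2) P
  centred : ∀ (t : ℝ) (i : Fin d), ∫ ω, coordProcess t ω i ∂P = 0
  covariance_eq : ∀ (s t : ℝ) (i j : Fin d),
    covariance (fun ω => coordProcess s ω i) (fun ω => coordProcess t ω j) P =
      if i = j then (|s| ^ (2 * H) + |t| ^ (2 * H) - |t - s| ^ (2 * H)) / 2 else 0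

/-! ### Matrices -/

/-- The operator norm on `ℝ^{d × d}` induced by the Euclidean norm of `ℝ^d`. -/
def matOpNorm {d : ℕ} (M : Matrix (Fin d) (Fin d) ℝ) : ℝ :=
  ‖Matrix.toEuclideanCLM (n := Fin d) (𝕜 := ℝ) M‖

/-- The product of a matrix and a vector of `ℝ^d`. -/
def matApply {d : ℕ} (M : Matrix (Fin d) (Fin d) ℝ) (x : EuclideanSpace ℝ (Fin d)) :
    EuclideanSpace ℝ (Fin d) :=
  Matrix.toEuclideanCLM (n := Fin d) (𝕜 := ℝ) M x

/-- `S(t) = exp(tA)`. -/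
def semigroupExp {d : ℕ} (A : Matrix (Fin d) (Fin d) ℝ) (t : ℝ) : Matrix (Fin d) (Fin d) ℝ :=
  NormedSpace.exp (t • A)

/-! ### The spaces `|𝓗|` and `|𝓗|_d` -/

/-- Membership of `h : ℝ → ℝ` in `|𝓗|`. -/
def MemAbsH (H : ℝ) (h : ℝ → ℝ) : Prop :=
  AEMeasurable h ∧
    ENNReal.ofReal (H * (2 * H - 1)) *
      ∫⁻ t, ∫⁻ s, ENNReal.ofReal (|t - s| ^ (2 * H - 2) * (|h s| * |h t|)) < ∞

/-- Membership of a matrix-valued function in `|𝓗|_d`: all entries are in `|𝓗|`. -/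
def MemAbsHMat {d : ℕ} (H : ℝ) (h : ℝ → Matrix (Fin d) (Fin d) ℝ) : Prop :=
  ∀ i j, MemAbsH H (fun u => h u i j)

/-! ### Wiener integrals -/

/-- Dissections `s = t_0 < t_1 < ⋯ < t_m = t` of `[s, t]`, `m ≥ 1` (only the values of `pts` at
`0, …, m` are used). -/
structure Dissection (s t : ℝ) where
  m : ℕ
  m_pos : 0 < m
  pts : ℕ → ℝ
  pts_zero : pts 0 = s
  pts_last : pts m = t
  pts_lt : ∀ k < m, pts k < pts (k + 1)

/-- The mesh of a dissection. -/
def Dissection.mesh {s t : ℝ} (D : Dissection s t) : ℝ :=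
  (Finset.range D.m).sup' (Finset.nonempty_range_iff.mpr D.m_pos.ne')
    (fun k => |D.pts (k + 1) - D.pts k|)

/-- The Riemann sum of `h` with respect to the `j`-th component of `B`. -/
def riemannSum {d : ℕ} (h : ℝ → ℝ) (j : Fin d) {s t : ℝ} (D : Dissection s t)
    (ω : FBmPath d) : ℝ :=
  ∑ k ∈ Finset.range D.m,
    h (D.pts k) * (coordProcess (D.pts (k + 1)) ω j - coordProcess (D.pts k) ω j)

/-- `J` is (a version of) the Wiener integral of the scalar function `h` on `[s, t]` with respect
to the `j`-th component of `B`: the `L²` limit of the Riemann sums along every sequence of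
dissections whose mesh tends to `0`. -/
def IsWienerIntegralComp {d : ℕ} (P : Measure (FBmPath d)) (h : ℝ → ℝ) (j : Fin d) (s t : ℝ)
    (J : FBmPath d → ℝ) : Prop :=
  MemLp J 2 P ∧
    ∀ D : ℕ → Dissection s t, Tendsto (fun n => (D n).mesh) atTop (𝓝 0) →
      Tendsto (fun n => eLpNorm (fun ω => J ω - riemannSum h j (D n) ω) 2 P) atTop (𝓝 0)

/-- `J` is (a version of) the Wiener integral `∫_s^t h dB` of the matrix-valued function `h`: its
`i`-th component is `∑_j ∫_s^t h_{ij} dB_j`. -/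
def IsWienerIntegral {d : ℕ} (P : Measure (FBmPath d)) (h : ℝ → Matrix (Fin d) (Fin d) ℝ)
    (s t : ℝ) (J : FBmPath d → EuclideanSpace ℝ (Fin d)) : Prop :=
  ∃ K : Fin d → Fin d → FBmPath d → ℝ,
    (∀ i j, IsWienerIntegralComp P (fun u => h u i j) j s t (K i j)) ∧
      ∀ᵐ ω ∂P, ∀ i, J ω i = ∑ j, K i j ω

/-- `J` is (a version of) the Wiener integral of `h` on `]-∞, t]`: the `L²` limit of
`∫_{-r}^t h dB` as `r → ∞`. -/
def IsWienerIntegralIic {d : ℕ} (P : Measure (FBmPath d)) (h : ℝ → Matrix (Fin d) (Fin d) ℝ)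
    (t : ℝ) (J : FBmPath d → EuclideanSpace ℝ (Fin d)) : Prop :=
  MemLp J 2 P ∧
    ∃ I : ℝ → FBmPath d → EuclideanSpace ℝ (Fin d),
      (∀ r : ℝ, -r < t → IsWienerIntegral P h (-r) t (I r)) ∧
        Tendsto (fun r => eLpNorm (fun ω => J ω - I r ω) 2 P) atTop (𝓝 0)

/-! ### Processes -/

/-- The translation `𝔗_τ Y(t, ω) = Y(t + τ, θ_{-τ} ω)`. -/
def thetaTranslation {d : ℕ} (τ : ℝ) (Y : ℝ → FBmPath d → EuclideanSpace ℝ (Fin d)) :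
    ℝ → FBmPath d → EuclideanSpace ℝ (Fin d) :=
  fun t ω => Y (t + τ) (wienerShift (-τ) ω)

/-- `Y` is `θ`-`τ`-periodic: `𝔗_τ Y(t) = Y(t)` as random variables (almost surely), for
every `t`. -/
def IsThetaPeriodic {d : ℕ} (P : Measure (FBmPath d)) (τ : ℝ)
    (Y : ℝ → FBmPath d → EuclideanSpace ℝ (Fin d)) : Prop :=
  ∀ t : ℝ, thetaTranslation τ Y t =ᵐ[P] Y t

/-- `Y` is uniformly bounded in square mean: `sup_t E‖Y(t)‖² < ∞`. -/
def IsL2Bounded {d : ℕ} (P : Measure (FBmPath d))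
    (Y : ℝ → FBmPath d → EuclideanSpace ℝ (Fin d)) : Prop :=
  ∃ C : ℝ≥0∞, C < ∞ ∧ ∀ t : ℝ, ∫⁻ ω, ‖Y t ω‖ₑ ^ 2 ∂P ≤ C

/-- `Y` is continuous in probability. -/
def IsStochContinuous {d : ℕ} (P : Measure (FBmPath d))
    (Y : ℝ → FBmPath d → EuclideanSpace ℝ (Fin d)) : Prop :=
  ∀ t : ℝ, TendstoInMeasure P Y (𝓝 t) (Y t)

/-- `X` solves `dX(t) = (A X(t) + b(t, X(t))) dt + σ(t) dB(t)`, `t ∈ ℝ`: for every `t`, almost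
surely, `X(t) = ∫_{-∞}^t S(t-s) b(s, X(s)) ds + ∫_{-∞}^t S(t-s) σ(s) dB(s)`, the first integral
being pathwise (and convergent), the second a Wiener integral (which exists). -/
def IsMildSolution {d : ℕ} (P : Measure (FBmPath d)) (A : Matrix (Fin d) (Fin d) ℝ)
    (b : ℝ → EuclideanSpace ℝ (Fin d) → EuclideanSpace ℝ (Fin d))
    (σ : ℝ → Matrix (Fin d) (Fin d) ℝ)
    (X : ℝ → FBmPath d → EuclideanSpace ℝ (Fin d)) : Prop :=
  ∀ t : ℝ, ∃ J : FBmPath d → EuclideanSpace ℝ (Fin d),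
    IsWienerIntegralIic P (fun s => semigroupExp A (t - s) * σ s) t J ∧
      ∀ᵐ ω ∂P,
        IntegrableOn (fun s => matApply (semigroupExp A (t - s)) (b s (X s ω))) (Iic t) ∧
          X t ω = (∫ s in Iic t, matApply (semigroupExp A (t - s)) (b s (X s ω))) + J ω

end

/-! The noise is additive, so once Z(t) = ∫_{-∞}^t S(t-s)σ(s) dB(s) has a version with continuous
paths, the equation becomes the pathwise fixed point problem x = drift x + Z(·, ω). The drift is
Lipschitz through the kernel cS cb e^{-mS(t-s)}, whose mass on ]-∞, t] is cS cb / mS < 1.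

Noise. For H > 1/2 the increments of B over disjoint intervals are nonnegatively correlated, because
x ↦ x^{2H} is convex. Hence each B_j, seen as a curve in L², has semivariation at most (t-s)^H
(`IsFBmLaw.hasSemivariation`), and Riemann sums of continuous functions converge
(`HasSemivariation.tendsto_curveInt`). Since S(t-s) = S(t)S(-s), Z(t) = S(t)N(t), where N is the
primitive of S(-s)σ(s). This integrand is O(e^{mS s}): the bound on S covers negative times too, and
σ is periodic, hence bounded. So N vanishes at -∞, its L² norm is O(e^{mS t}), and Z is bounded in
L². Kolmogorov's criterion, with exponent 2H > 1, gives continuous paths. The Wiener shift preserves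
the law, and primitives are unique, so almost surely Z(t+τ, θ_{-τ}ω) = Z(t, ω) for all t at once
(`exists_wienerConvolution`).

Existence. Almost every path of Z is integrable against e^{-ε|s|}. In this weighted L¹ space the
Picard map is a contraction for small ε, so the iterates converge path by path
(`DriftBounds.exists_tendsto_picard`). The limit is bounded in L² by a uniform bound on the iterates
(`DriftBounds.exists_lintegral_picard_le`) and Fatou. It is θ-periodic because the iterates commute
with time translation by τ (`picard_add_period`).

Uniqueness. For two solutions, sup_t E‖X(t) - Y(t)‖ is finite and at most cS cb / mS times itself,
hence zero (`DriftBounds.ae_eq_of_mild`). -/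

/-! ### Gaussian laws and invariance of the fractional Brownian law under the Wiener shift. -/

theorem IsGaussianProcess.map_eq_of_covariance_eq {T Ω : Type*} [MeasurableSpace Ω]
    {P : Measure Ω} {X Y : T → Ω → ℝ} (hX : IsGaussianProcess X P) (hY : IsGaussianProcess Y P)
    (hXm : AEMeasurable (fun ω t => X t ω) P) (hYm : AEMeasurable (fun ω t => Y t ω) P)
    (hmean : ∀ t, ∫ ω, X t ω ∂P = ∫ ω, Y t ω ∂P)
    (hcov : ∀ s t, covariance (X s) (X t) P = covariance (Y s) (Y t) P) :
    P.map (fun ω t => X t ω) = P.map (fun ω t => Y t ω) := by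
  classical
  have := hX.isProbabilityMeasure
  rw [map_eq_iff_forall_finset_map_restrict_eq hXm hYm]
  intro I
  have hX2 : ∀ i, MemLp (X i) 2 P := fun i => (hX.hasGaussianLaw_eval i).memLp_two
  have hY2 : ∀ i, MemLp (Y i) 2 P := fun i => (hY.hasGaussianLaw_eval i).memLp_two
  have hIX := hX.hasGaussianLaw I
  have hIY := hY.hasGaussianLaw I
  have := hIX.isGaussian_map
  have := hIY.isGaussian_map
  -- The characteristic function of a Gaussian vector at L depends only on the mean and variance of
  -- L, and these expand into the given means and covariances.
  apply Measure.ext_of_charFunDual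
  ext L
  have key : ∀ Z : T → Ω → ℝ, (fun ω => L (I.restrict (Z · ω))) =
      fun ω => ∑ i : I, L (Pi.single i 1) * Z i ω := by
    intro Z
    ext ω
    conv_lhs => rw [← Finset.univ_sum_single (I.restrict (Z · ω)), map_sum]
    refine Finset.sum_congr rfl fun i _ => ?_
    rw [mul_comm, ← smul_eq_mul, ← map_smul]
    congr 1
    ext j
    simp [Pi.single_apply, Finset.restrict]
  rw [hIX.charFunDual_map_eq_fun, hIY.charFunDual_map_eq_fun, key X, key Y]
  have hm : ∫ ω, ∑ i : I, L (Pi.single i 1) * X i ω ∂P = ∫ ω, ∑ i : I, L (Pi.single i 1) * Y i ω ∂P := by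
    rw [integral_finsetSum _ fun (i : I) _ => ((hX2 i).integrable (by norm_num)).const_mul _,
      integral_finsetSum _ fun (i : I) _ => ((hY2 i).integrable (by norm_num)).const_mul _]
    simp [integral_const_mul, hmean]
  have hv : variance (fun ω => ∑ i : I, L (Pi.single i 1) * X i ω) P =
      variance (fun ω => ∑ i : I, L (Pi.single i 1) * Y i ω) P := by
    have hX3 : ∀ i : I, MemLp (fun ω => L (Pi.single i 1) * X i ω) 2 P := fun i => (hX2 i).const_mul _
    have hY3 : ∀ i : I, MemLp (fun ω => L (Pi.single i 1) * Y i ω) 2 P := fun i => (hY2 i).const_mul _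
    rw [← covariance_self, ← covariance_self, covariance_fun_sum_fun_sum hX3 hX3,
      covariance_fun_sum_fun_sum hY3 hY3]
    · simp [covariance_const_mul_left, covariance_const_mul_right, hcov]
    · exact (memLp_finsetSum _ fun i _ => hY3 i).aestronglyMeasurable.aemeasurable
    · exact (memLp_finsetSum _ fun i _ => hX3 i).aestronglyMeasurable.aemeasurable
  rw [hm, hv]

section FBm

variable {d : ℕ}

theorem measurable_coordProcess (t : ℝ) : Measurable (coordProcess (d := d) t) :=
  (measurable_pi_apply t).comp (comap_measurable fun (ω : FBmPath d) t => coordProcess t ω)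

theorem measurable_coordProcess_apply (t : ℝ) (i : Fin d) :
    Measurable (fun ω : FBmPath d => coordProcess t ω i) := by
  have := measurable_coordProcess (d := d) t
  fun_prop

theorem coordProcess_wienerShift (r t : ℝ) (ω : FBmPath d) :
    coordProcess t (wienerShift r ω) = coordProcess (r + t) ω - coordProcess r ω := rfl

theorem measurable_wienerShift (r : ℝ) : Measurable (wienerShift (d := d) r) := by
  refine measurable_comap_iff.2 (measurable_pi_lambda _ fun t => ?_)
  exact (measurable_coordProcess (r + t)).sub (measurable_coordProcess r)

theorem IsFBmLaw.memLp {H : ℝ} {P : Measure (FBmPath d)} (hP : IsFBmLaw H P) (t : ℝ) (i : Fin d) :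
    MemLp (fun ω => coordProcess t ω i) 2 P :=
  (hP.gaussian.hasGaussianLaw_eval (t, i)).memLp_two

/-- The increments of B are stationary: in the covariance of shifted coordinates every term
involving the base point r cancels. H > 0 enters through 0^{2H} = 0. -/
theorem IsFBmLaw.measurePreserving_wienerShift {H : ℝ} {P : Measure (FBmPath d)}
    [IsProbabilityMeasure P] (hP : IsFBmLaw H P) (hH : 0 < H) (r : ℝ) :
    MeasurePreserving (wienerShift r) P P := by
  refine ⟨measurable_wienerShift r, ?_⟩
  have hcoord : Measurable fun (ω : FBmPath d) (p : ℝ × Fin d) => coordProcess p.1 ω p.2 :=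
    measurable_pi_lambda _ fun p => measurable_coordProcess_apply p.1 p.2
  have hshift : Measurable fun (ω : FBmPath d) (p : ℝ × Fin d) =>
      coordProcess p.1 (wienerShift r ω) p.2 := hcoord.comp (measurable_wienerShift r)
  have hlaw := IsGaussianProcess.map_eq_of_covariance_eq (P := P)
    (X := fun (p : ℝ × Fin d) ω => coordProcess p.1 (wienerShift r ω) p.2)
    (Y := fun (p : ℝ × Fin d) ω => coordProcess p.1 ω p.2) ?_ hP.gaussian
    hshift.aemeasurable hcoord.aemeasurable ?_ ?_
  -- The path σ-algebra is also generated by the scalar coordinates (t, i), so equality of laws on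
  -- the product space `ℝ × Fin d → ℝ` suffices.
  · have hcomap : FBmPath.instMeasurableSpace d = MeasurableSpace.comap
        (fun (ω : FBmPath d) (p : ℝ × Fin d) => coordProcess p.1 ω p.2) MeasurableSpace.pi := by
      refine le_antisymm ?_ hcoord.comap_le
      refine measurable_iff_comap_le.1 ?_
      refine @measurable_pi_lambda _ _ _ (MeasurableSpace.comap _ _) _ _ fun t => ?_
      have h1 : @Measurable _ _ (MeasurableSpace.comap
        (fun (ω : FBmPath d) (p : ℝ × Fin d) => coordProcess p.1 ω p.2) MeasurableSpace.pi) _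
          (fun (ω : FBmPath d) (i : Fin d) => coordProcess t ω i) := by
        refine @measurable_pi_lambda _ _ _ (MeasurableSpace.comap _ _) _ _ fun i => ?_
        exact (measurable_pi_apply (t, i)).comp
          (comap_measurable fun (ω : FBmPath d) (p : ℝ × Fin d) => coordProcess p.1 ω p.2)
      exact (PiLp.continuous_toLp 2 _).measurable.comp h1
    ext s hs
    have hs' := hs
    rw [hcomap] at hs'
    obtain ⟨u, hu, rfl⟩ := hs'
    have := congrArg (fun μ => μ u) hlaw
    simp only at this
    rw [Measure.map_apply hshift hu, Measure.map_apply hcoord hu] at this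
    rw [Measure.map_apply (measurable_wienerShift r) hs]
    exact this
  · classical
    refine hP.gaussian.of_isGaussianProcess fun p => ⟨{(r + p.1, p.2), (r, p.2)},
      { toFun x := x ⟨(r + p.1, p.2), by simp⟩ - x ⟨(r, p.2), by simp⟩
        map_add' x y := by simp; abel
        map_smul' c x := by simp; ring }, fun ω => ?_⟩
    rfl
  · intro p
    have h1 : (fun ω => coordProcess p.1 (wienerShift r ω) p.2) = fun ω : FBmPath d =>
      coordProcess (r + p.1) ω p.2 - coordProcess r ω p.2 := rfl
    rw [h1, integral_sub ((hP.memLp _ _).integrable (by norm_num))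
      ((hP.memLp _ _).integrable (by norm_num))]
    simp [hP.centred]
  · intro p q
    have h1 : ∀ p : ℝ × Fin d, (fun ω => coordProcess p.1 (wienerShift r ω) p.2) =
      fun ω : FBmPath d => coordProcess (r + p.1) ω p.2 - coordProcess r ω p.2 := fun _ => rfl
    rw [h1, h1, covariance_fun_sub_fun_sub (hP.memLp _ _) (hP.memLp _ _) (hP.memLp _ _)
      (hP.memLp _ _)]
    simp only [hP.covariance_eq]
    split_ifs with h
    · have e1 : r + q.1 - (r + p.1) = q.1 - p.1 := by ring
      have e2 : |r - (r + p.1)| = |p.1| := by rw [← abs_neg]; congr 1; ring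
      have e3 : |r + q.1 - r| = |q.1| := by congr 1; ring
      rw [e1, e2, e3]
      have h2 : 2 * H ≠ 0 := by positivity
      simp only [sub_self, abs_zero, Real.zero_rpow h2]
      ring
    · simp

end FBm

/-! ### Riemann integration of scalar functions against curves of bounded semivariation. -/

noncomputable section

namespace Dissection

variable {s t : ℝ}

theorem pts_mono (D : Dissection s t) {k l : ℕ} (hkl : k ≤ l) (hl : l ≤ D.m) :
    D.pts k ≤ D.pts l := by
  induction l, hkl using Nat.le_induction with
  | base => exact le_rfl
  | succ n _ ih => exact (ih (by omega)).trans (D.pts_lt n (by omega)).le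

theorem pts_mem (D : Dissection s t) {k : ℕ} (hk : k ≤ D.m) : D.pts k ∈ Icc s t :=
  ⟨by simpa [D.pts_zero] using D.pts_mono (Nat.zero_le k) hk,
    by simpa [D.pts_last] using D.pts_mono hk le_rfl⟩

theorem abs_sub_le_mesh (D : Dissection s t) {k : ℕ} (hk : k < D.m) :
    |D.pts (k + 1) - D.pts k| ≤ D.mesh :=
  Finset.le_sup' (fun k => |D.pts (k + 1) - D.pts k|) (Finset.mem_range.2 hk)

theorem mesh_nonneg (D : Dissection s t) : 0 ≤ D.mesh :=
  (abs_nonneg _).trans (D.abs_sub_le_mesh D.m_pos)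

/-- The dissection of `[s, t]` into `n + 1` intervals of equal length. -/
def uniform (h : s < t) (n : ℕ) : Dissection s t where
  m := n + 1
  m_pos := n.succ_pos
  pts k := s + k * ((t - s) / (n + 1))
  pts_zero := by simp
  pts_last := by push_cast; field_simp; ring
  pts_lt k _ := by
    have : 0 < (t - s) / (n + 1) := div_pos (sub_pos.2 h) (by positivity)
    push_cast
    linarith

theorem mesh_uniform (h : s < t) (n : ℕ) : (uniform h n).mesh = (t - s) / (n + 1) := by
  have : 0 < (t - s) / (n + 1) := div_pos (sub_pos.2 h) (by positivity)
  have hk : ∀ k : ℕ, |(uniform h n).pts (k + 1) - (uniform h n).pts k| = (t - s) / (n + 1) := by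
    intro k
    simp only [uniform]
    rw [show s + ((k + 1 : ℕ) : ℝ) * ((t - s) / (n + 1)) - (s + k * ((t - s) / (n + 1))) =
      (t - s) / (n + 1) by push_cast; ring, abs_of_pos this]
  simp only [mesh, hk, Finset.sup'_const]

theorem tendsto_mesh_uniform (h : s < t) :
    Tendsto (fun n => (uniform h n).mesh) atTop (𝓝 0) := by
  simp only [mesh_uniform]
  exact tendsto_const_div_atTop_nhds_zero_nat (t - s) |>.comp (tendsto_add_atTop_nat 1) |>.congr
    fun n => by simp

/-- The dissection with the single interval `[s, t]`. -/
def single (h : s < t) : Dissection s t where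
  m := 1
  m_pos := one_pos
  pts k := if k = 0 then s else t
  pts_zero := by simp
  pts_last := by simp
  pts_lt k hk := by
    obtain rfl : k = 0 := by omega
    simpa using h

/-- The translate of a dissection. -/
def translate (D : Dissection s t) (r : ℝ) : Dissection (s + r) (t + r) where
  m := D.m
  m_pos := D.m_pos
  pts k := D.pts k + r
  pts_zero := by rw [D.pts_zero]
  pts_last := by rw [D.pts_last]
  pts_lt k hk := by linarith [D.pts_lt k hk]

theorem mesh_translate (D : Dissection s t) (r : ℝ) : (D.translate r).mesh = D.mesh := by
  simp [mesh, translate]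

/-- The filter of dissections whose mesh tends to `0`. -/
def fine (s t : ℝ) : Filter (Dissection s t) := comap mesh (𝓝 0)

theorem tendsto_fine {ι : Type*} {l : Filter ι} {D : ι → Dissection s t}
    (h : Tendsto (fun n => (D n).mesh) l (𝓝 0)) : Tendsto D l (fine s t) :=
  tendsto_comap_iff.2 h

theorem fine_neBot (h : s < t) : (fine s t).NeBot :=
  (tendsto_fine (tendsto_mesh_uniform h)).neBot

end Dissection

variable {E : Type*} [NormedAddCommGroup E] [NormedSpace ℝ E]

/-- Riemann sums of a scalar function against a curve in a normed space. -/
def curveSum (β : ℝ → E) (h : ℝ → ℝ) {s t : ℝ} (D : Dissection s t) : E :=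
  ∑ k ∈ Finset.range D.m, h (D.pts k) • (β (D.pts (k + 1)) - β (D.pts k))

/-- The curve `β` has semivariation at most `(t - s) ^ H` on each interval `[s, t]`. -/
def HasSemivariation (H : ℝ) (β : ℝ → E) : Prop :=
  ∀ (s t : ℝ) (D : Dissection s t) (a : ℕ → ℝ) (M : ℝ), (∀ k < D.m, |a k| ≤ M) →
    ‖∑ k ∈ Finset.range D.m, a k • (β (D.pts (k + 1)) - β (D.pts k))‖ ≤ M * (t - s) ^ H

/-- The integral of a polynomial against a continuous curve, by parts. -/
def polyInt (β : ℝ → E) (q : Polynomial ℝ) (s t : ℝ) : E :=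
  q.eval t • β t - q.eval s • β s - ∫ u in s..t, q.derivative.eval u • β u

/-- The integral of a continuous function against a curve, as the limit of Riemann sums. -/
def curveInt (β : ℝ → E) (h : ℝ → ℝ) (s t : ℝ) : E :=
  lim (map (curveSum β h) (Dissection.fine s t))

namespace HasSemivariation

variable {H : ℝ} {β : ℝ → E}

theorem norm_increment_le (hβ : HasSemivariation H β) {s t : ℝ} (h : s < t) :
    ‖β t - β s‖ ≤ (t - s) ^ H := by
  have := hβ s t (Dissection.single h) (fun _ => 1) 1 (by simp)
  simpa [Dissection.single] using this

theorem continuous (hβ : HasSemivariation H β) (hH : 0 < H) : Continuous β := by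
  refine continuous_iff_continuousAt.2 fun s => ?_
  rw [ContinuousAt, tendsto_iff_norm_sub_tendsto_zero]
  have h0 : Tendsto (fun t : ℝ => |t - s| ^ H) (𝓝 s) (𝓝 0) := by
    have : Continuous fun t : ℝ => |t - s| ^ H :=
      (continuous_abs.comp (continuous_id.sub continuous_const)).rpow_const fun _ => Or.inr hH.le
    simpa [Real.zero_rpow hH.ne'] using this.tendsto s
  refine squeeze_zero (fun _ => norm_nonneg _) (fun t => ?_) h0
  rcases lt_trichotomy t s with h | rfl | h
  · rw [norm_sub_rev, abs_sub_comm, abs_of_pos (sub_pos.2 h)]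
    exact hβ.norm_increment_le h
  · simp [Real.zero_rpow hH.ne']
  · rw [abs_of_pos (sub_pos.2 h)]
    exact hβ.norm_increment_le h

theorem norm_curveSum_le (hβ : HasSemivariation H β) {h : ℝ → ℝ} {s t M : ℝ}
    (hM : ∀ u ∈ Icc s t, |h u| ≤ M) (D : Dissection s t) :
    ‖curveSum β h D‖ ≤ M * (t - s) ^ H :=
  hβ s t D _ M fun _ hk => hM _ (D.pts_mem hk.le)

theorem norm_curveSum_sub_le (hβ : HasSemivariation H β) {h g : ℝ → ℝ} {s t M : ℝ}
    (hM : ∀ u ∈ Icc s t, |h u - g u| ≤ M) (D : Dissection s t) :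
    ‖curveSum β h D - curveSum β g D‖ ≤ M * (t - s) ^ H := by
  have : curveSum β h D - curveSum β g D = curveSum β (fun u => h u - g u) D := by
    simp only [curveSum, ← Finset.sum_sub_distrib, sub_smul]
  rw [this]
  exact hβ.norm_curveSum_le hM D

theorem polyInt_add (hβ : Continuous β) (q : Polynomial ℝ) (r s t : ℝ) :
    polyInt β q r s + polyInt β q s t = polyInt β q r t := by
  have hc : Continuous fun u => q.derivative.eval u • β u := q.derivative.continuous.smul hβ
  rw [polyInt, polyInt, polyInt, ← intervalIntegral.integral_add_adjacent_intervals
    (hc.intervalIntegrable r s) (hc.intervalIntegrable s t)]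
  abel

variable [CompleteSpace E]

/-- Integration by parts on a single cell: the error of the left-point rule involves only increments
of β inside the cell, which are at most mesh^H. -/
theorem polyInt_sub (hβ : Continuous β) (q : Polynomial ℝ) (s t : ℝ) :
    polyInt β q s t - q.eval s • (β t - β s) =
      ∫ u in s..t, q.derivative.eval u • (β t - β u) := by
  have hc : Continuous fun u => q.derivative.eval u • β u := q.derivative.continuous.smul hβ
  have hq : ∫ u in s..t, q.derivative.eval u = q.eval t - q.eval s :=
    intervalIntegral.integral_eq_sub_of_hasDerivAt (fun u _ => q.hasDerivAt u)
      (q.derivative.continuous.intervalIntegrable _ _)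
  have hc' : Continuous fun u => q.derivative.eval u • β t :=
    q.derivative.continuous.smul continuous_const
  simp_rw [smul_sub]
  rw [intervalIntegral.integral_sub (hc'.intervalIntegrable _ _)
    (hc.intervalIntegrable _ _), intervalIntegral.integral_smul_const, hq, polyInt, sub_smul]
  abel

theorem norm_curveSum_sub_polyInt_le (hβ : HasSemivariation H β) (hH : 0 < H)
    (q : Polynomial ℝ) {s t C : ℝ} (hC : ∀ u ∈ Icc s t, |q.derivative.eval u| ≤ C)
    (D : Dissection s t) :
    ‖curveSum β (fun u => q.eval u) D - polyInt β q s t‖ ≤ C * D.mesh ^ H * (t - s) := by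
  have hc := hβ.continuous hH
  have hsum : ∀ n, ∑ k ∈ Finset.range n, polyInt β q (D.pts k) (D.pts (k + 1)) =
      polyInt β q (D.pts 0) (D.pts n) := by
    intro n
    induction n with
    | zero => simp [polyInt]
    | succ n ih => rw [Finset.sum_range_succ, ih, polyInt_add hc]
  have hm := hsum D.m
  rw [D.pts_zero, D.pts_last] at hm
  rw [norm_sub_rev, ← hm, curveSum, ← Finset.sum_sub_distrib]
  have htel := Finset.sum_range_sub D.pts D.m
  rw [D.pts_zero, D.pts_last] at htel
  rw [← htel, Finset.mul_sum]
  refine (norm_sum_le _ _).trans (Finset.sum_le_sum fun k hk => ?_)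
  have hk' := Finset.mem_range.1 hk
  have hlt := D.pts_lt k hk'
  have hmesh := D.abs_sub_le_mesh hk'
  rw [abs_of_pos (sub_pos.2 hlt)] at hmesh
  rw [polyInt_sub hc]
  refine (intervalIntegral.norm_integral_le_of_norm_le_const (C := C * D.mesh ^ H)
    fun u hu => ?_).trans_eq (by rw [abs_of_pos (sub_pos.2 hlt)])
  rw [uIoc_of_le hlt.le] at hu
  rw [norm_smul, Real.norm_eq_abs]
  have hCu := hC u ⟨(D.pts_mem hk'.le).1.trans hu.1.le, hu.2.trans (D.pts_mem hk').2⟩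
  refine mul_le_mul hCu ?_ (norm_nonneg _) ((abs_nonneg _).trans hCu)
  rcases hu.2.eq_or_lt with rfl | hu2
  · simpa using Real.rpow_nonneg D.mesh_nonneg H
  · refine (hβ.norm_increment_le hu2).trans ?_
    exact Real.rpow_le_rpow (sub_nonneg.2 hu2.le) (by linarith [hu.1]) hH.le

theorem tendsto_curveSum_poly (hβ : HasSemivariation H β) (hH : 0 < H)
    (q : Polynomial ℝ) (s t : ℝ) :
    Tendsto (curveSum β fun u => q.eval u) (Dissection.fine s t) (𝓝 (polyInt β q s t)) := by
  obtain ⟨C, hC⟩ := (isCompact_Icc (a := s) (b := t)).exists_bound_of_continuousOn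
    q.derivative.continuous.continuousOn
  rw [tendsto_iff_norm_sub_tendsto_zero]
  refine squeeze_zero (fun _ => norm_nonneg _)
    (fun D => hβ.norm_curveSum_sub_polyInt_le hH q hC D) ?_
  have h1 : Tendsto (fun D : Dissection s t => D.mesh ^ H) (Dissection.fine s t) (𝓝 0) := by
    have : Tendsto (fun x : ℝ => x ^ H) (𝓝 0) (𝓝 0) := by
      simpa [Real.zero_rpow hH.ne'] using
        (Real.continuous_rpow_const hH.le).tendsto (0 : ℝ)
    exact this.comp tendsto_comap
  simpa using (h1.const_mul C).mul_const (t - s)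

theorem tendsto_curveInt (hβ : HasSemivariation H β) (hH : 0 < H) {h : ℝ → ℝ} {s t : ℝ}
    (hst : s < t) (hh : ContinuousOn h (Icc s t)) :
    Tendsto (curveSum β h) (Dissection.fine s t) (𝓝 (curveInt β h s t)) := by
  have := Dissection.fine_neBot hst
  suffices hcau : Cauchy (map (curveSum β h) (Dissection.fine s t)) from
    le_nhds_lim (CompleteSpace.complete hcau)
  rw [Metric.cauchy_iff]
  refine ⟨inferInstance, fun ε hε => ?_⟩
  have hpos : 0 < (t - s) ^ H := Real.rpow_pos_of_pos (sub_pos.2 hst) H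
  -- Weierstrass approximation. Semivariation makes Riemann sums Lipschitz in the sup norm of the
  -- integrand, uniformly in the dissection, so replacing h by q costs at most ε / 4.
  obtain ⟨q, hq⟩ := exists_polynomial_near_of_continuousOn s t h hh (ε / 4 / (t - s) ^ H)
    (by positivity)
  have hev := (hβ.tendsto_curveSum_poly hH q s t).eventually
    (Metric.ball_mem_nhds _ (show (0 : ℝ) < ε / 4 by positivity))
  refine ⟨_, image_mem_map hev, ?_⟩
  have key : ∀ D : Dissection s t, dist (curveSum β (fun u => q.eval u) D) (polyInt β q s t) < ε / 4 →
      dist (curveSum β h D) (polyInt β q s t) < ε / 2 := by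
    intro D hD
    have h1 := hβ.norm_curveSum_sub_le (fun u hu => (abs_sub_comm _ _).trans_le (hq u hu).le) D
    rw [div_mul_cancel₀ _ hpos.ne', ← dist_eq_norm] at h1
    linarith [dist_triangle (curveSum β h D) (curveSum β (fun u => q.eval u) D) (polyInt β q s t)]
  rintro _ ⟨D, hD, rfl⟩ _ ⟨D', hD', rfl⟩
  have h1 := key D hD
  have h2 := key D' hD'
  linarith [dist_triangle_right (curveSum β h D) (curveSum β h D') (polyInt β q s t)]

theorem norm_curveInt_le (hβ : HasSemivariation H β) (hH : 0 < H) {h : ℝ → ℝ} {s t M : ℝ}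
    (hst : s < t) (hh : ContinuousOn h (Icc s t)) (hM : ∀ u ∈ Icc s t, |h u| ≤ M) :
    ‖curveInt β h s t‖ ≤ M * (t - s) ^ H := by
  have := Dissection.fine_neBot hst
  exact le_of_tendsto (hβ.tendsto_curveInt hH hst hh).norm
    (Eventually.of_forall fun D => hβ.norm_curveSum_le hM D)

theorem norm_curveInt_sub_polyInt_le (hβ : HasSemivariation H β) (hH : 0 < H) {h : ℝ → ℝ}
    {s t M : ℝ} (hst : s < t) (hh : ContinuousOn h (Icc s t)) {q : Polynomial ℝ}
    (hM : ∀ u ∈ Icc s t, |h u - q.eval u| ≤ M) :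
    ‖curveInt β h s t - polyInt β q s t‖ ≤ M * (t - s) ^ H := by
  have := Dissection.fine_neBot hst
  exact le_of_tendsto
    ((hβ.tendsto_curveInt hH hst hh).sub (hβ.tendsto_curveSum_poly hH q s t)).norm
    (Eventually.of_forall fun D => hβ.norm_curveSum_sub_le hM D)

/-- Additivity is exact for polynomials by `polyInt_add` and passes to continuous integrands by
uniform approximation, which avoids concatenating dissections. -/
theorem curveInt_add (hβ : HasSemivariation H β) (hH : 0 < H) {h : ℝ → ℝ} (hh : Continuous h)
    {r s t : ℝ} (hrs : r < s) (hst : s < t) :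
    curveInt β h r s + curveInt β h s t = curveInt β h r t := by
  rw [← sub_eq_zero, ← norm_le_zero_iff]
  refine le_of_forall_pos_le_add fun ε hε => ?_
  rw [zero_add]
  set c := (s - r) ^ H + (t - s) ^ H + (t - r) ^ H with hc
  have hpos : 0 < c := by
    have := Real.rpow_pos_of_pos (sub_pos.2 hst) H
    have := Real.rpow_pos_of_pos (sub_pos.2 hrs) H
    have := Real.rpow_pos_of_pos (sub_pos.2 (hrs.trans hst)) H
    positivity
  obtain ⟨q, hq⟩ := exists_polynomial_near_of_continuousOn r t h hh.continuousOn (ε / c)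
    (by positivity)
  have hq' : ∀ u ∈ Icc r t, |h u - q.eval u| ≤ ε / c := fun u hu =>
    (abs_sub_comm _ _).trans_le (hq u hu).le
  have h1 := hβ.norm_curveInt_sub_polyInt_le hH hrs hh.continuousOn
    fun u hu => hq' u ⟨hu.1, hu.2.trans hst.le⟩
  have h2 := hβ.norm_curveInt_sub_polyInt_le hH hst hh.continuousOn
    fun u hu => hq' u ⟨hrs.le.trans hu.1, hu.2⟩
  have h3 := hβ.norm_curveInt_sub_polyInt_le hH (hrs.trans hst) hh.continuousOn hq'
  have heq : curveInt β h r s + curveInt β h s t - curveInt β h r t =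
      (curveInt β h r s - polyInt β q r s) + (curveInt β h s t - polyInt β q s t) -
        (curveInt β h r t - polyInt β q r t) := by
    rw [← polyInt_add (hβ.continuous hH) q r s t]
    abel
  rw [heq]
  refine ((norm_sub_le _ _).trans
    (add_le_add ((norm_add_le _ _).trans (add_le_add h1 h2)) h3)).trans_eq ?_
  rw [← mul_add, ← mul_add, ← hc, div_mul_cancel₀ _ hpos.ne']

/-- Cutting [s, t] into blocks of length at most one, backwards from t, bounds the contributions by
a geometric series of ratio e^{-m}. The constant K = C / (1 - e^{-m}) solves K e^{-m} + C = K, which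
closes the induction; it does not depend on s. -/
theorem norm_curveInt_le_exp (hβ : HasSemivariation H β) (hH : 0 < H) {h : ℝ → ℝ}
    (hh : Continuous h) {C m : ℝ} (hC : 0 ≤ C) (hm : 0 < m)
    (hbd : ∀ u, |h u| ≤ C * Real.exp (m * u)) {s t : ℝ} (hst : s < t) :
    ‖curveInt β h s t‖ ≤ C / (1 - Real.exp (-m)) * Real.exp (m * t) := by
  have he : Real.exp (-m) < 1 := by simpa using hm
  have he1 : 0 < 1 - Real.exp (-m) := by linarith
  have hshort : ∀ s t : ℝ, s < t → t - s ≤ 1 → ‖curveInt β h s t‖ ≤ C * Real.exp (m * t) := by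
    intro s t hst h1
    refine (hβ.norm_curveInt_le hH hst hh.continuousOn (M := C * Real.exp (m * t))
      fun u hu => (hbd u).trans ?_).trans ?_
    · gcongr; exact hu.2
    · exact mul_le_of_le_one_right (by positivity)
        (Real.rpow_le_one (sub_nonneg.2 hst.le) h1 hH.le)
  have hlong : ∀ n : ℕ, ∀ s t : ℝ, s < t → t - s ≤ n + 1 →
      ‖curveInt β h s t‖ ≤ C / (1 - Real.exp (-m)) * Real.exp (m * t) := by
    intro n
    induction n with
    | zero =>
      intro s t hst h1
      refine (hshort s t hst (by simpa using h1)).trans ?_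
      gcongr
      rw [le_div_iff₀ he1]
      exact mul_le_of_le_one_right hC (by linarith [Real.exp_pos (-m)])
    | succ n ih =>
      intro s t hst h1
      by_cases h2 : t - s ≤ n + 1
      · exact ih s t hst h2
      push Not at h2
      have hn : (0 : ℝ) ≤ n := n.cast_nonneg
      push_cast at h1
      rw [← hβ.curveInt_add hH hh (show s < t - 1 by linarith) (show t - 1 < t by linarith)]
      refine (norm_add_le _ _).trans ((add_le_add (ih s (t - 1) (by linarith) (by linarith))
        (hshort (t - 1) t (by linarith) (by linarith))).trans_eq ?_)
      rw [show m * (t - 1) = m * t + -m by ring, Real.exp_add]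
      field_simp
      ring
  obtain ⟨n, hn⟩ := exists_nat_ge (t - s)
  exact hlong n s t hst (by linarith)

/-- The primitive, vanishing at `-∞`, of an integrand that decays exponentially at `-∞`. -/
theorem exists_primitive (hβ : HasSemivariation H β) (hH : 0 < H) {h : ℝ → ℝ}
    (hh : Continuous h) {C m : ℝ} (hC : 0 ≤ C) (hm : 0 < m)
    (hbd : ∀ u, |h u| ≤ C * Real.exp (m * u)) :
    ∃ N : ℝ → E, (∀ s t, s < t → N t - N s = curveInt β h s t) ∧
      ∀ t, ‖N t‖ ≤ C / (1 - Real.exp (-m)) * Real.exp (m * t) := by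
  have hexp : ∀ s t, s < t → ‖curveInt β h s t‖ ≤ C / (1 - Real.exp (-m)) * Real.exp (m * t) :=
    fun s t hst => hβ.norm_curveInt_le_exp hH hh hC hm hbd hst
  have hlim : Tendsto (fun r : ℝ => C / (1 - Real.exp (-m)) * Real.exp (m * r)) atBot (𝓝 0) := by
    simpa using (Real.tendsto_exp_atBot.comp (tendsto_id.const_mul_atBot hm)).const_mul
      (C / (1 - Real.exp (-m)))
  -- Changing the lower endpoint adds an integral over an interval ending far to the left, which
  -- `hexp` makes small: the Cauchy criterion as r → -∞.
  have hex : ∀ t, ∃ x, Tendsto (fun r => curveInt β h r t) atBot (𝓝 x) := by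
    intro t
    refine CompleteSpace.complete (f := map (fun r => curveInt β h r t) atBot) ?_
    rw [Metric.cauchy_iff]
    refine ⟨inferInstance, fun ε hε => ?_⟩
    obtain ⟨R, hR⟩ := eventually_atBot.1 ((hlim.eventually (gt_mem_nhds hε)).and
      (eventually_lt_atBot t))
    refine ⟨_, image_mem_map (Iic_mem_atBot R), ?_⟩
    have key : ∀ r r', r < r' → r' ≤ R → dist (curveInt β h r t) (curveInt β h r' t) < ε := by
      intro r r' hrr hr'
      rw [← hβ.curveInt_add hH hh hrr (hR r' hr').2, dist_eq_norm, add_sub_cancel_right]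
      exact (hexp r r' hrr).trans_lt (hR r' hr').1
    rintro _ ⟨r, hr, rfl⟩ _ ⟨r', hr', rfl⟩
    rcases lt_trichotomy r r' with h1 | rfl | h1
    · exact key r r' h1 hr'
    · simpa using hε
    · rw [dist_comm]; exact key r' r h1 hr
  choose N hN using hex
  refine ⟨N, fun s t hst => ?_, fun t => ?_⟩
  · refine tendsto_nhds_unique ((hN t).sub (hN s)) (tendsto_const_nhds.congr' ?_)
    filter_upwards [eventually_lt_atBot s] with r hr
    rw [← hβ.curveInt_add hH hh hr hst, add_sub_cancel_left]
  · refine le_of_tendsto (hN t).norm ?_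
    filter_upwards [eventually_lt_atBot t] with r hr using hexp r t hr

end HasSemivariation

end

/-! ### Fractional Brownian motion as a curve in L², and Wiener integrals on compact intervals. -/

noncomputable section

/-- The points p + x and p + y are convex combinations of p and p + x + y with exchanged weights;
adding the two convexity inequalities gives the claim. -/
theorem ConvexOn.add_le_add_of_Ici {f : ℝ → ℝ} (hf : ConvexOn ℝ (Ici 0) f) {p x y : ℝ}
    (hp : 0 ≤ p) (hx : 0 ≤ x) (hy : 0 ≤ y) :
    f (p + x) + f (p + y) ≤ f (p + x + y) + f p := by
  rcases (add_nonneg hx hy).eq_or_lt with h | h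
  · obtain rfl : x = 0 := by linarith
    obtain rfl : y = 0 := by linarith
    simp
  have hsum : y / (x + y) + x / (x + y) = 1 := by field_simp; ring
  have h1 := hf.2 (show p ∈ Ici (0 : ℝ) from hp) (show p + x + y ∈ Ici (0 : ℝ) by
    simp only [mem_Ici]; positivity) (div_nonneg hy h.le) (div_nonneg hx h.le) hsum
  have h2 := hf.2 (show p ∈ Ici (0 : ℝ) from hp) (show p + x + y ∈ Ici (0 : ℝ) by
    simp only [mem_Ici]; positivity) (div_nonneg hx h.le) (div_nonneg hy h.le)
    (by rw [add_comm]; exact hsum)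
  simp only [smul_eq_mul] at h1 h2
  rw [show y / (x + y) * p + x / (x + y) * (p + x + y) = p + x by field_simp; ring] at h1
  rw [show x / (x + y) * p + y / (x + y) * (p + x + y) = p + y by field_simp; ring] at h2
  have h3 : (y / (x + y) + x / (x + y)) * (f (p + x + y) + f p) = f (p + x + y) + f p := by
    rw [hsum, one_mul]
  linarith

/-- When all inner products are nonnegative, expanding the square shows that the norm is largest if
every coefficient equals M. -/
theorem norm_sum_smul_le_of_inner_nonneg {F : Type*} [NormedAddCommGroup F]
    [InnerProductSpace ℝ F] {n : ℕ} {v : ℕ → F} {a : ℕ → ℝ} {M : ℝ} (hn : 0 < n)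
    (hv : ∀ k < n, ∀ l < n, 0 ≤ inner ℝ (v k) (v l)) (ha : ∀ k < n, |a k| ≤ M) :
    ‖∑ k ∈ Finset.range n, a k • v k‖ ≤ M * ‖∑ k ∈ Finset.range n, v k‖ := by
  have hM : 0 ≤ M := (abs_nonneg _).trans (ha 0 hn)
  refine le_of_sq_le_sq ?_ (by positivity)
  rw [mul_pow, ← real_inner_self_eq_norm_sq, ← real_inner_self_eq_norm_sq]
  simp only [sum_inner, inner_sum, Finset.mul_sum]
  refine Finset.sum_le_sum fun k hk => Finset.sum_le_sum fun l hl => ?_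
  rw [Finset.mem_range] at hk hl
  rw [real_inner_smul_left, real_inner_smul_right, ← mul_assoc]
  refine mul_le_mul_of_nonneg_right ?_ (hv _ ‹_› _ ‹_›)
  refine (le_abs_self _).trans ?_
  rw [abs_mul, sq]
  exact mul_le_mul (ha _ ‹_›) (ha _ ‹_›) (abs_nonneg _) hM

variable {d : ℕ} {H : ℝ} {P : Measure (FBmPath d)}

/-- The `j`-th component of the canonical process as a curve in `L²`. -/
def IsFBmLaw.curve (hP : IsFBmLaw H P) (j : Fin d) (t : ℝ) : Lp ℝ 2 P := (hP.memLp t j).toLp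

theorem IsFBmLaw.inner_curve [IsProbabilityMeasure P] (hP : IsFBmLaw H P) (j : Fin d) (s t : ℝ) :
    inner ℝ (hP.curve j s) (hP.curve j t) =
      (|s| ^ (2 * H) + |t| ^ (2 * H) - |t - s| ^ (2 * H)) / 2 := by
  have hc := hP.covariance_eq s t j j
  rw [if_pos rfl, covariance_eq_sub (hP.memLp s j) (hP.memLp t j), hP.centred, zero_mul,
    sub_zero] at hc
  rw [← hc, L2.inner_def]
  refine integral_congr_ae ?_
  filter_upwards [(hP.memLp s j).coeFn_toLp, (hP.memLp t j).coeFn_toLp] with ω h1 h2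
  rw [IsFBmLaw.curve, IsFBmLaw.curve, h1, h2]
  simp [mul_comm]

theorem IsFBmLaw.inner_curve_sub [IsProbabilityMeasure P] (hP : IsFBmLaw H P) (j : Fin d)
    (r s t u : ℝ) :
    inner ℝ (hP.curve j s - hP.curve j r) (hP.curve j u - hP.curve j t) =
      (|u - r| ^ (2 * H) + |t - s| ^ (2 * H) - |t - r| ^ (2 * H) - |u - s| ^ (2 * H)) / 2 := by
  simp only [inner_sub_left, inner_sub_right, hP.inner_curve]
  ring

/-- Convexity of x ↦ x^{2H}, with p = t - s, x = s - r, y = u - t, makes increments over ordered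
intervals nonnegatively correlated. The extremal sum then telescopes to B_j(t) - B_j(s), of L² norm
(t - s)^H. -/
theorem IsFBmLaw.hasSemivariation [IsProbabilityMeasure P] (hP : IsFBmLaw H P) (hH : 1 / 2 < H)
    (j : Fin d) : HasSemivariation H (hP.curve j) := by
  have hconv : ConvexOn ℝ (Ici 0) fun x : ℝ => x ^ (2 * H) := convexOn_rpow (by linarith)
  have hzero : (0 : ℝ) ^ (2 * H) = 0 := Real.zero_rpow (by linarith)
  have hcross : ∀ r s t u : ℝ, r ≤ s → s ≤ t → t ≤ u →
      0 ≤ inner ℝ (hP.curve j s - hP.curve j r) (hP.curve j u - hP.curve j t) := by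
    intro r s t u hrs hst htu
    have h := hconv.add_le_add_of_Ici (sub_nonneg.2 hst) (sub_nonneg.2 hrs) (sub_nonneg.2 htu)
    simp only [show t - s + (s - r) = t - r by ring, show t - s + (u - t) = u - s by ring,
      show t - r + (u - t) = u - r by ring] at h
    rw [hP.inner_curve_sub, abs_of_nonneg (show 0 ≤ u - r by linarith),
      abs_of_nonneg (show 0 ≤ t - s by linarith), abs_of_nonneg (show 0 ≤ t - r by linarith),
      abs_of_nonneg (show 0 ≤ u - s by linarith)]
    linarith
  intro s t D a M ha
  have hle : s ≤ t := by simpa [D.pts_zero] using (D.pts_mem (Nat.zero_le _)).2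
  refine (norm_sum_smul_le_of_inner_nonneg D.m_pos (fun k hk l hl => ?_) ha).trans_eq ?_
  · rcases lt_trichotomy k l with h | rfl | h
    · exact hcross _ _ _ _ (D.pts_lt k hk).le (D.pts_mono h hl.le) (D.pts_lt l hl).le
    · exact real_inner_self_nonneg
    · rw [real_inner_comm]
      exact hcross _ _ _ _ (D.pts_lt l hl).le (D.pts_mono h hk.le) (D.pts_lt k hk).le
  · rw [Finset.sum_range_sub (fun k => hP.curve j (D.pts k)), D.pts_zero, D.pts_last]
    congr 1
    rw [norm_eq_sqrt_real_inner, hP.inner_curve_sub, abs_of_nonneg (sub_nonneg.2 hle),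
      abs_sub_comm s t, abs_of_nonneg (sub_nonneg.2 hle), sub_self, sub_self, abs_zero, hzero,
      sub_zero, sub_zero, Real.sqrt_eq_rpow, add_self_div_two,
      ← Real.rpow_mul (sub_nonneg.2 hle)]
    congr 1
    ring

theorem IsFBmLaw.memLp_riemannSum (hP : IsFBmLaw H P) (h : ℝ → ℝ) (j : Fin d) {s t : ℝ}
    (D : Dissection s t) : MemLp (riemannSum h j D) 2 P :=
  memLp_finsetSum _ fun _ _ => ((hP.memLp _ j).sub (hP.memLp _ j)).const_mul _

theorem IsFBmLaw.coeFn_curveSum (hP : IsFBmLaw H P) (h : ℝ → ℝ) (j : Fin d) {s t : ℝ}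
    (D : Dissection s t) : ⇑(curveSum (hP.curve j) h D) =ᵐ[P] riemannSum h j D := by
  have key : ∀ n, ⇑(∑ k ∈ Finset.range n,
      h (D.pts k) • (hP.curve j (D.pts (k + 1)) - hP.curve j (D.pts k))) =ᵐ[P] fun ω =>
        ∑ k ∈ Finset.range n,
          h (D.pts k) * (coordProcess (D.pts (k + 1)) ω j - coordProcess (D.pts k) ω j) := by
    intro n
    induction n with
    | zero =>
      simp only [Finset.range_zero, Finset.sum_empty]
      exact Lp.coeFn_zero ℝ 2 P
    | succ n ih =>
      rw [Finset.sum_range_succ]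
      filter_upwards [ih, Lp.coeFn_add (∑ k ∈ Finset.range n,
        h (D.pts k) • (hP.curve j (D.pts (k + 1)) - hP.curve j (D.pts k)))
          (h (D.pts n) • (hP.curve j (D.pts (n + 1)) - hP.curve j (D.pts n))),
        Lp.coeFn_smul (h (D.pts n)) (hP.curve j (D.pts (n + 1)) - hP.curve j (D.pts n)),
        Lp.coeFn_sub (hP.curve j (D.pts (n + 1))) (hP.curve j (D.pts n)),
        (hP.memLp (D.pts (n + 1)) j).coeFn_toLp, (hP.memLp (D.pts n) j).coeFn_toLp]
        with ω h1 h2 h3 h4 h5 h6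
      rw [Finset.sum_range_succ, h2, Pi.add_apply, h1, h3, Pi.smul_apply, h4, Pi.sub_apply,
        smul_eq_mul, IsFBmLaw.curve, IsFBmLaw.curve, h5, h6]
  exact key D.m

theorem IsFBmLaw.isWienerIntegralComp_curveInt [IsProbabilityMeasure P] (hP : IsFBmLaw H P)
    (hH : 1 / 2 < H) {h : ℝ → ℝ} (hh : Continuous h) (j : Fin d) {s t : ℝ} (hst : s < t) :
    IsWienerIntegralComp P h j s t ⇑(curveInt (hP.curve j) h s t) := by
  refine ⟨Lp.memLp _, fun D hD => ?_⟩
  have hlim := ((hP.hasSemivariation hH j).tendsto_curveInt (by linarith) hst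
    hh.continuousOn).comp (Dissection.tendsto_fine hD)
  rw [tendsto_iff_edist_tendsto_0] at hlim
  refine hlim.congr fun n => ?_
  rw [edist_comm, Lp.edist_def]
  refine eLpNorm_congr_ae ?_
  filter_upwards [hP.coeFn_curveSum h j (D n)] with ω hω
  simp [hω]

namespace IsWienerIntegralComp

variable {h : ℝ → ℝ} {j : Fin d} {s t : ℝ} {J J' : FBmPath d → ℝ}

theorem congr_ae (hJ : IsWienerIntegralComp P h j s t J) (hJJ' : J =ᵐ[P] J') :
    IsWienerIntegralComp P h j s t J' := by
  refine ⟨(memLp_congr_ae hJJ').1 hJ.1, fun D hD => (hJ.2 D hD).congr fun n => ?_⟩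
  exact eLpNorm_congr_ae (hJJ'.sub (EventuallyEq.refl _ _))

theorem ae_eq (hP : IsFBmLaw H P) (hst : s < t) (hJ : IsWienerIntegralComp P h j s t J)
    (hJ' : IsWienerIntegralComp P h j s t J') : J =ᵐ[P] J' := by
  have h1 := hJ.2 _ (Dissection.tendsto_mesh_uniform hst)
  have h2 := hJ'.2 _ (Dissection.tendsto_mesh_uniform hst)
  have h3 : eLpNorm (J - J') 2 P ≤ 0 := by
    refine ge_of_tendsto' (by simpa using h1.add h2) fun n => ?_
    have hR := hP.memLp_riemannSum h j (Dissection.uniform hst n)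
    have : J - J' = (fun ω => J ω - riemannSum h j (Dissection.uniform hst n) ω) -
        fun ω => J' ω - riemannSum h j (Dissection.uniform hst n) ω := by
      ext ω; simp
    rw [this]
    exact eLpNorm_sub_le (hJ.1.sub hR).1 (hJ'.1.sub hR).1 (by norm_num)
  have h4 := (eLpNorm_eq_zero_iff (hJ.1.sub hJ'.1).1 (by norm_num)).1 (le_antisymm h3 bot_le)
  filter_upwards [h4] with ω hω
  simpa [sub_eq_zero] using hω

theorem finset_sum (hP : IsFBmLaw H P) {ι : Type*} (S : Finset ι) (c : ι → ℝ)
    {h : ι → ℝ → ℝ} {J : ι → FBmPath d → ℝ} (hJ : ∀ i, IsWienerIntegralComp P (h i) j s t (J i)) :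
    IsWienerIntegralComp P (fun u => ∑ i ∈ S, c i * h i u) j s t
      (fun ω => ∑ i ∈ S, c i * J i ω) := by
  refine ⟨memLp_finsetSum _ fun i _ => (hJ i).1.const_mul _, fun D hD => ?_⟩
  have hlim : Tendsto (fun n => ∑ i ∈ S, ‖c i‖ₑ *
      eLpNorm (fun ω => J i ω - riemannSum (h i) j (D n) ω) 2 P) atTop (𝓝 0) := by
    have : Tendsto (fun n => ∑ i ∈ S, ‖c i‖ₑ *
        eLpNorm (fun ω => J i ω - riemannSum (h i) j (D n) ω) 2 P) atTop
          (𝓝 (∑ i ∈ S, ‖c i‖ₑ * 0)) :=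
      tendsto_finsetSum _ fun i _ => ENNReal.Tendsto.const_mul ((hJ i).2 D hD) (Or.inr (by simp))
    simpa using this
  refine tendsto_of_tendsto_of_tendsto_of_le_of_le tendsto_const_nhds hlim (fun _ => bot_le)
    fun n => ?_
  have heq : (fun ω => ∑ i ∈ S, c i * J i ω - riemannSum (fun u => ∑ i ∈ S, c i * h i u) j (D n) ω) =
      ∑ i ∈ S, c i • fun ω => J i ω - riemannSum (h i) j (D n) ω := by
    ext ω
    simp only [riemannSum, Finset.sum_apply, Pi.smul_apply, smul_eq_mul, mul_sub (c _),
      Finset.sum_sub_distrib, Finset.sum_mul, Finset.mul_sum, mul_assoc]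
    rw [Finset.sum_comm (s := S)]
  simp only
  rw [heq]
  refine (eLpNorm_sum_le (fun i _ => (((hJ i).1.sub
    (hP.memLp_riemannSum _ _ _)).const_smul _).1) (by norm_num)).trans ?_
  exact Finset.sum_le_sum fun i _ => (eLpNorm_const_smul _ _ _ _).le

/-- Riemann sums contain only increments, so the base value of the shifted path cancels: a sum over
the translated dissection, composed with θ_{-r}, is the sum of h(· + r) over the original one.
Composition with θ_{-r} preserves L² norms. -/
theorem comp_wienerShift [IsProbabilityMeasure P] (hP : IsFBmLaw H P) (hH : 0 < H) {r : ℝ}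
    (hJ : IsWienerIntegralComp P h j (s + r) (t + r) J) :
    IsWienerIntegralComp P (fun u => h (u + r)) j s t (fun ω => J (wienerShift (-r) ω)) := by
  have hmp := hP.measurePreserving_wienerShift hH (-r)
  refine ⟨hJ.1.comp_measurePreserving hmp, fun D hD => ?_⟩
  refine (hJ.2 (fun n => (D n).translate r) (by simpa [Dissection.mesh_translate] using hD)).congr
    fun n => ?_
  have hcomp := eLpNorm_comp_measurePreserving (p := 2) (hJ.1.sub (hP.memLp_riemannSum h j ((D n).translate r))).1 hmp
  refine hcomp.symm.trans ?_
  congr 1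
  ext ω
  simp [riemannSum, Dissection.translate, coordProcess_wienerShift]

end IsWienerIntegralComp

end

/-! ### A Kolmogorov continuity criterion by dyadic approximation. -/

noncomputable section

/-- The step function that agrees with `f` on the grid of mesh `2⁻ⁿ`. -/
def dyadicStep {α : Type*} (f : ℝ → α) (n : ℕ) (t : ℝ) : α := f (⌊(2 : ℝ) ^ n * t⌋ / 2 ^ n)

section Deterministic

variable {f : ℝ → ℝ} {e : ℕ → ℝ} {R : ℕ}

theorem floor_mem_of_mem_Ico {t : ℝ} (ht : t ∈ Ico (-R : ℝ) R) (n : ℕ) :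
    -(R * 2 ^ n : ℤ) ≤ ⌊(2 : ℝ) ^ n * t⌋ ∧ ⌊(2 : ℝ) ^ n * t⌋ < R * 2 ^ n := by
  have h2 : (0 : ℝ) < 2 ^ n := by positivity
  rw [Int.le_floor, Int.floor_lt]
  push_cast
  constructor
  · nlinarith [ht.1]
  · nlinarith [ht.2]

/-- Refining the grid turns the index k into 2k or 2k + 1: the grid point stays, or moves by one
cell of level n + 1. -/
theorem dist_dyadicStep_succ_le (he : ∀ n, 0 ≤ e n)
    (hf : ∀ (n : ℕ) (k : ℤ), -(R * 2 ^ n : ℤ) ≤ k → k < R * 2 ^ n →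
      |f ((k + 1) / 2 ^ n) - f (k / 2 ^ n)| ≤ e n) {t : ℝ} (ht : t ∈ Ico (-R : ℝ) R) (n : ℕ) :
    dist (dyadicStep f n t) (dyadicStep f (n + 1) t) ≤ e (n + 1) := by
  set k := ⌊(2 : ℝ) ^ n * t⌋ with hk
  have h1 : (k : ℝ) ≤ 2 ^ n * t := Int.floor_le _
  have h2 : 2 ^ n * t < k + 1 := Int.lt_floor_add_one _
  have hR := floor_mem_of_mem_Ico ht n
  have hcases : ⌊(2 : ℝ) ^ (n + 1) * t⌋ = 2 * k ∨ ⌊(2 : ℝ) ^ (n + 1) * t⌋ = 2 * k + 1 := by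
    have h3 : 2 * k ≤ ⌊(2 : ℝ) ^ (n + 1) * t⌋ := by
      rw [Int.le_floor, pow_succ]
      push_cast
      linarith
    have h4 : ⌊(2 : ℝ) ^ (n + 1) * t⌋ < 2 * k + 2 := by
      rw [Int.floor_lt, pow_succ]
      push_cast
      linarith
    omega
  have hdiv : ((2 * k : ℤ) : ℝ) / 2 ^ (n + 1) = k / 2 ^ n := by
    rw [pow_succ]
    push_cast
    field_simp
  rcases hcases with h | h
  · rw [dyadicStep, dyadicStep, h, hdiv, dist_self]
    exact he _
  · rw [← hk] at hR
    have h5 := hf (n + 1) (2 * k) (by rw [pow_succ, ← mul_assoc]; linarith [hR.1])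
      (by rw [pow_succ, ← mul_assoc]; linarith [hR.2])
    rw [dist_comm, dyadicStep, dyadicStep, h, ← hk, Real.dist_eq]
    rw [hdiv] at h5
    push_cast at h5 ⊢
    exact h5

theorem exists_tendsto_dyadicStep (he : ∀ n, 0 ≤ e n) (hes : Summable e)
    (hf : ∀ (n : ℕ) (k : ℤ), -(R * 2 ^ n : ℤ) ≤ k → k < R * 2 ^ n →
      |f ((k + 1) / 2 ^ n) - f (k / 2 ^ n)| ≤ e n) {t : ℝ} (ht : t ∈ Ico (-R : ℝ) R) :
    ∃ x, Tendsto (fun n => dyadicStep f n t) atTop (𝓝 x) :=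
  cauchySeq_tendsto_of_complete (cauchySeq_of_dist_le_of_summable _
    (dist_dyadicStep_succ_le he hf ht) ((summable_nat_add_iff 1).2 hes))

/-- The step functions converge uniformly, by the tail of e, and at level n points closer than 2⁻ⁿ
have indices differing by at most one, hence values differing by at most e n. -/
theorem continuousOn_of_tendsto_dyadicStep (he : ∀ n, 0 ≤ e n) (hes : Summable e)
    (hf : ∀ (n : ℕ) (k : ℤ), -(R * 2 ^ n : ℤ) ≤ k → k < R * 2 ^ n →
      |f ((k + 1) / 2 ^ n) - f (k / 2 ^ n)| ≤ e n) {g : ℝ → ℝ}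
    (hg : ∀ t ∈ Ioo (-R : ℝ) R, Tendsto (fun n => dyadicStep f n t) atTop (𝓝 (g t))) :
    ContinuousOn g (Ioo (-R : ℝ) R) := by
  have hes' := (summable_nat_add_iff 1).2 hes
  have htail : ∀ t ∈ Ioo (-R : ℝ) R, ∀ n, dist (dyadicStep f n t) (g t) ≤ ∑' m, e (n + m + 1) :=
    fun t ht n => dist_le_tsum_of_dist_le_of_tendsto (fun n => e (n + 1))
      (dist_dyadicStep_succ_le he hf ⟨ht.1.le, ht.2⟩) hes' (hg t ht) n
  have htail0 : Tendsto (fun n => ∑' m, e (n + m + 1)) atTop (𝓝 0) := by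
    simpa [add_comm] using tendsto_sum_nat_add (fun n => e (n + 1))
  refine Metric.continuousOn_iff.2 fun t ht ε hε => ?_
  obtain ⟨n, hn1, hn2⟩ := ((htail0.eventually (gt_mem_nhds (show (0 : ℝ) < ε / 3 by positivity))).and
    (hes.tendsto_atTop_zero.eventually (gt_mem_nhds (show (0 : ℝ) < ε / 3 by positivity)))).exists
  have h2 : (0 : ℝ) < 2 ^ n := by positivity
  have hstep : ∀ s ∈ Ioo (-R : ℝ) R, ∀ t ∈ Ioo (-R : ℝ) R, s ≤ t → t - s < 1 / 2 ^ n →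
      dist (dyadicStep f n s) (dyadicStep f n t) ≤ e n := by
    intro s hs t ht hst hlt
    have hle : ⌊(2 : ℝ) ^ n * s⌋ ≤ ⌊(2 : ℝ) ^ n * t⌋ := Int.floor_le_floor (by gcongr)
    have hlt' : ⌊(2 : ℝ) ^ n * t⌋ < ⌊(2 : ℝ) ^ n * s⌋ + 2 := by
      rw [Int.floor_lt]
      push_cast
      rw [lt_div_iff₀ h2] at hlt
      nlinarith [Int.lt_floor_add_one ((2 : ℝ) ^ n * s)]
    obtain h | h : ⌊(2 : ℝ) ^ n * t⌋ = ⌊(2 : ℝ) ^ n * s⌋ ∨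
      ⌊(2 : ℝ) ^ n * t⌋ = ⌊(2 : ℝ) ^ n * s⌋ + 1 := by omega
    · rw [dyadicStep, dyadicStep, h, dist_self]
      exact he n
    · have hs' := floor_mem_of_mem_Ico ⟨hs.1.le, hs.2⟩ n
      have := hf n _ hs'.1 hs'.2
      rw [dist_comm, dyadicStep, dyadicStep, h, Real.dist_eq]
      push_cast
      exact this
  refine ⟨1 / 2 ^ n, by positivity, fun s hs hst => ?_⟩
  have hmid : dist (dyadicStep f n s) (dyadicStep f n t) ≤ e n := by
    rw [Real.dist_eq, abs_lt] at hst
    rcases le_total s t with h | h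
    · exact hstep s hs t ht h (by linarith)
    · rw [dist_comm]
      exact hstep t ht s hs h (by linarith)
  have h3 := htail s hs n
  have h4 := htail t ht n
  have h5 := dist_triangle4 (g s) (dyadicStep f n s) (dyadicStep f n t) (g t)
  rw [dist_comm (g s) (dyadicStep f n s)] at h5
  linarith

end Deterministic

theorem ae_summable_of_tsum_lintegral_ne_top {Ω : Type*} [MeasurableSpace Ω] {P : Measure Ω}
    {f : ℕ → Ω → ℝ} (hf : ∀ n, Measurable (f n)) (hf0 : ∀ n ω, 0 ≤ f n ω)
    (h : ∑' n, ∫⁻ ω, ENNReal.ofReal (f n ω) ∂P ≠ ∞) : ∀ᵐ ω ∂P, Summable fun n => f n ω := by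
  rw [← lintegral_tsum fun n => (hf n).ennreal_ofReal.aemeasurable] at h
  filter_upwards [ae_lt_top' (AEMeasurable.tsum
    fun n => (hf n).ennreal_ofReal.aemeasurable) h] with ω hω
  have := ENNReal.summable_toReal hω.ne
  simpa [ENNReal.toReal_ofReal (hf0 _ ω)] using this

theorem ENNReal.tsum_ofReal_const_mul_pow_ne_top {c r : ℝ} (hr0 : 0 ≤ r) (hr : r < 1) (hc : 0 ≤ c) :
    ∑' n : ℕ, ENNReal.ofReal (c * r ^ n) ≠ ∞ := by
  rw [← ENNReal.ofReal_tsum_of_nonneg (fun n => by positivity)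
    ((summable_geometric_of_lt_one hr0 hr).mul_left c)]
  exact ENNReal.ofReal_ne_top

theorem ae_summable_dyadic_increments {Ω : Type*} [MeasurableSpace Ω] {P : Measure Ω}
    [IsProbabilityMeasure P] {N : ℝ → Ω → ℝ} (hNm : ∀ t, Measurable (N t)) {q C : ℝ} (hq : 1 < q)
    (hC : 0 ≤ C) (R : ℕ) (hN : ∀ s t, -(R : ℝ) ≤ s → s < t → t ≤ R →
      ∫⁻ ω, ENNReal.ofReal ((N t ω - N s ω) ^ 2) ∂P ≤ ENNReal.ofReal (C * (t - s) ^ q)) :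
    ∀ᵐ ω ∂P, ∃ e : ℕ → ℝ, (∀ n, 0 ≤ e n) ∧ Summable e ∧
      ∀ (n : ℕ) (k : ℤ), -(R * 2 ^ n : ℤ) ≤ k → k < R * 2 ^ n →
        |N ((k + 1) / 2 ^ n) ω - N (k / 2 ^ n) ω| ≤ e n := by
  -- Level n has 2R·2ⁿ cells, each of mean square increment at most C 2^{-nq}, so the expected sum
  -- of squares is at most 2RC r^{2n}; r < 1 because q > 1.
  set r : ℝ := Real.sqrt (2 ^ (-(q - 1))) with hr
  have hr0 : 0 < r := Real.sqrt_pos.2 (by positivity)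
  have hr2 : r ^ 2 = 2 ^ (-(q - 1)) := Real.sq_sqrt (by positivity)
  have hr1 : r < 1 := by
    rw [hr, Real.sqrt_lt' one_pos, one_pow]
    exact Real.rpow_lt_one_of_one_lt_of_neg (by norm_num) (by linarith)
  let S : ℕ → Finset ℤ := fun n => Finset.Ico (-(R * 2 ^ n)) (R * 2 ^ n)
  -- The inequality a ≤ a² / rⁿ + rⁿ bounds every increment of level n by e n, while E e n ≤ (2RC +
  -- 1) rⁿ is summable.
  let e : ℕ → Ω → ℝ := fun n ω =>
    (∑ k ∈ S n, (N ((k + 1) / 2 ^ n) ω - N (k / 2 ^ n) ω) ^ 2) / r ^ n + r ^ n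
  have he0 : ∀ n ω, 0 ≤ e n ω := fun n ω => by
    have : 0 ≤ ∑ k ∈ S n, (N ((k + 1) / 2 ^ n) ω - N (k / 2 ^ n) ω) ^ 2 :=
      Finset.sum_nonneg fun _ _ => sq_nonneg _
    positivity
  have hsq : ∀ k n, Measurable fun ω => (N (((k : ℤ) + 1) / 2 ^ n) ω - N (k / 2 ^ n) ω) ^ 2 :=
    fun k n => ((hNm _).sub (hNm _)).pow_const 2
  have hem : ∀ n, Measurable (e n) := fun n =>
    ((Finset.measurable_fun_sum _ fun k _ => hsq k n).div_const _).add_const _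
  have hint : ∀ n, ∫⁻ ω, ENNReal.ofReal (e n ω) ∂P ≤ ENNReal.ofReal ((2 * R * C + 1) * r ^ n) := by
    intro n
    have h2n : (0 : ℝ) < 2 ^ n := by positivity
    have hterm : ∀ k ∈ S n, ∫⁻ ω, ENNReal.ofReal ((N ((k + 1) / 2 ^ n) ω - N (k / 2 ^ n) ω) ^ 2) ∂P ≤
        ENNReal.ofReal (C * (1 / 2 ^ n) ^ q) := by
      intro k hk
      rw [Finset.mem_Ico] at hk
      have hk1 : -(R * 2 ^ n : ℝ) ≤ k := by exact_mod_cast hk.1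
      have hk2 : (k : ℝ) + 1 ≤ R * 2 ^ n := by exact_mod_cast hk.2
      refine (hN (k / 2 ^ n) ((k + 1) / 2 ^ n) ?_ ?_ ?_).trans_eq ?_
      · rw [le_div_iff₀ h2n]; nlinarith
      · gcongr; linarith
      · rw [div_le_iff₀ h2n]; nlinarith
      · rw [← sub_div, add_sub_cancel_left]
    have hsum : ∫⁻ ω, ENNReal.ofReal (∑ k ∈ S n, (N ((k + 1) / 2 ^ n) ω - N (k / 2 ^ n) ω) ^ 2) ∂P ≤
        ENNReal.ofReal (2 * R * C * (r ^ n) ^ 2) := by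
      have h1 : ∀ ω, ENNReal.ofReal (∑ k ∈ S n, (N ((k + 1) / 2 ^ n) ω - N (k / 2 ^ n) ω) ^ 2) =
        ∑ k ∈ S n, ENNReal.ofReal ((N ((k + 1) / 2 ^ n) ω - N (k / 2 ^ n) ω) ^ 2) := fun ω =>
        ENNReal.ofReal_sum_of_nonneg fun _ _ => sq_nonneg _
      simp_rw [h1]
      rw [lintegral_finsetSum _ fun k _ => (hsq k n).ennreal_ofReal]
      refine (Finset.sum_le_sum hterm).trans_eq ?_
      have hcard : ((S n).card : ℝ) = 2 * R * 2 ^ n := by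
        have : (S n).card = 2 * R * 2 ^ n := by
          rw [Int.card_Ico, sub_neg_eq_add, ← two_mul]
          have : (2 * (R * 2 ^ n) : ℤ) = ((2 * R * 2 ^ n : ℕ) : ℤ) := by push_cast; ring
          rw [this, Int.toNat_natCast]
        rw [this]; push_cast; ring
      rw [Finset.sum_const, nsmul_eq_mul, ← ENNReal.ofReal_natCast,
        ← ENNReal.ofReal_mul (Nat.cast_nonneg _), hcard]
      congr 1
      have h3 : (r ^ n) ^ 2 = 2 ^ n * (1 / 2 ^ n : ℝ) ^ q := by
        rw [← pow_mul, mul_comm n 2, pow_mul, hr2, one_div, ← Real.rpow_natCast 2 n,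
          ← Real.rpow_neg (by norm_num), ← Real.rpow_mul (by norm_num),
          ← Real.rpow_add (by norm_num), ← Real.rpow_natCast, ← Real.rpow_mul (by norm_num)]
        congr 1
        ring
      rw [h3]
      ring
    have h4 : ∀ ω, ENNReal.ofReal (e n ω) = ENNReal.ofReal (1 / r ^ n) * ENNReal.ofReal
        (∑ k ∈ S n, (N ((k + 1) / 2 ^ n) ω - N (k / 2 ^ n) ω) ^ 2) + ENNReal.ofReal (r ^ n) := by
      intro ω
      have h0 : 0 ≤ ∑ k ∈ S n, (N ((k + 1) / 2 ^ n) ω - N (k / 2 ^ n) ω) ^ 2 :=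
        Finset.sum_nonneg fun _ _ => sq_nonneg _
      rw [← ENNReal.ofReal_mul (by positivity), ← ENNReal.ofReal_add (by positivity) (by positivity)]
      congr 1
      simp only [e]
      ring
    simp_rw [h4]
    rw [lintegral_add_right _ measurable_const, lintegral_const_mul _
      (Finset.measurable_fun_sum _ fun k _ => hsq k n).ennreal_ofReal, lintegral_const,
      measure_univ, mul_one]
    calc _ ≤ ENNReal.ofReal (1 / r ^ n) * ENNReal.ofReal (2 * R * C * (r ^ n) ^ 2) +
          ENNReal.ofReal (r ^ n) := by gcongr
      _ = _ := by
        rw [← ENNReal.ofReal_mul (by positivity), ← ENNReal.ofReal_add (by positivity) (by positivity)]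
        congr 1
        field_simp
  have hfin : ∑' n, ∫⁻ ω, ENNReal.ofReal (e n ω) ∂P ≠ ∞ :=
    ne_top_of_le_ne_top (ENNReal.tsum_ofReal_const_mul_pow_ne_top hr0.le hr1 (by positivity))
      (ENNReal.tsum_le_tsum hint)
  filter_upwards [ae_summable_of_tsum_lintegral_ne_top hem he0 hfin] with ω hω
  refine ⟨fun n => e n ω, fun n => he0 n ω, hω, fun n k hk1 hk2 => ?_⟩
  have hrn : 0 < r ^ n := pow_pos hr0 n
  set a := |N ((k + 1) / 2 ^ n) ω - N (k / 2 ^ n) ω| with ha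
  have h1 : a ^ 2 / r ^ n ≤
      (∑ k ∈ S n, (N ((k + 1) / 2 ^ n) ω - N (k / 2 ^ n) ω) ^ 2) / r ^ n := by
    gcongr
    rw [ha, sq_abs]
    exact Finset.single_le_sum
      (f := fun k : ℤ => (N ((k + 1) / 2 ^ n) ω - N (k / 2 ^ n) ω) ^ 2)
      (fun _ _ => sq_nonneg _) (Finset.mem_Ico.2 ⟨hk1, hk2⟩)
  refine le_trans ?_ (add_le_add_left h1 _)
  rw [div_add' _ _ _ hrn.ne', le_div_iff₀ hrn]
  nlinarith [sq_nonneg (a - r ^ n), abs_nonneg (N ((k + 1) / 2 ^ n) ω - N (k / 2 ^ n) ω)]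

/-- A process whose increments satisfy `E|N t - N s|² ≤ C (t - s)^q` locally, with `q > 1`, has a
continuous modification. -/
theorem exists_continuous_modification {Ω : Type*} [MeasurableSpace Ω] {P : Measure Ω}
    [IsProbabilityMeasure P] {N : ℝ → Ω → ℝ} (hNm : ∀ t, Measurable (N t)) {q : ℝ} (hq : 1 < q)
    (hN : ∀ R : ℕ, ∃ C : ℝ, 0 ≤ C ∧ ∀ s t, -(R : ℝ) ≤ s → s < t → t ≤ R →
      ∫⁻ ω, ENNReal.ofReal ((N t ω - N s ω) ^ 2) ∂P ≤ ENNReal.ofReal (C * (t - s) ^ q)) :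
    ∃ M : ℝ → Ω → ℝ, (∀ ω, Continuous fun t => M t ω) ∧ (∀ t, Measurable (M t)) ∧
      ∀ t, M t =ᵐ[P] N t := by
  have hae : ∀ᵐ ω ∂P, ∀ R : ℕ, ∃ e : ℕ → ℝ, (∀ n, 0 ≤ e n) ∧ Summable e ∧
      ∀ (n : ℕ) (k : ℤ), -(R * 2 ^ n : ℤ) ≤ k → k < R * 2 ^ n →
        |N ((k + 1) / 2 ^ n) ω - N (k / 2 ^ n) ω| ≤ e n := by
    refine ae_all_iff.2 fun R => ?_
    obtain ⟨C, hC, hCN⟩ := hN R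
    exact ae_summable_dyadic_increments hNm hq hC R hCN
  -- Setting the process to zero off a measurable set of full measure gives continuity and
  -- measurability for every ω.
  obtain ⟨G, hG, hGm, hG1⟩ := hae.exists_measurable_mem
  have hlim : ∀ t ω, ∃ x, Tendsto (fun n => G.indicator (fun ω => dyadicStep (N · ω) n t) ω)
      atTop (𝓝 x) := by
    intro t ω
    by_cases hω : ω ∈ G
    · obtain ⟨R, hR⟩ := exists_nat_gt |t|
      obtain ⟨e, he, hes, hf⟩ := hG1 ω hω R
      simp only [indicator_of_mem hω]
      exact exists_tendsto_dyadicStep he hes hf ⟨(abs_lt.1 hR).1.le, (abs_lt.1 hR).2⟩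
    · simp only [indicator_of_notMem hω]
      exact ⟨0, tendsto_const_nhds⟩
  choose M hM using hlim
  refine ⟨M, fun ω => ?_, fun t => ?_, fun t => ?_⟩
  · by_cases hω : ω ∈ G
    · have hM' := fun t => hM t ω
      simp only [indicator_of_mem hω] at hM'
      refine continuous_iff_continuousAt.2 fun t => ?_
      obtain ⟨R, hR⟩ := exists_nat_gt |t|
      obtain ⟨e, he, hes, hf⟩ := hG1 ω hω R
      exact (continuousOn_of_tendsto_dyadicStep he hes hf fun t _ => hM' t).continuousAt
        (Ioo_mem_nhds (abs_lt.1 hR).1 (abs_lt.1 hR).2)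
    · have hM' := fun t => hM t ω
      simp only [indicator_of_notMem hω] at hM'
      have : (fun t => M t ω) = fun _ => 0 :=
        funext fun t => tendsto_nhds_unique (hM' t) tendsto_const_nhds
      rw [this]
      exact continuous_const
  · exact measurable_of_tendsto_metrizable (fun n => (hNm _).indicator hGm)
      (tendsto_pi_nhds.2 fun ω => hM t ω)
  -- The margin 1 keeps the dyadic points below t inside [-R, R]. Summable mean square errors give
  -- almost sure convergence of the approximations to N t.
  · obtain ⟨R, hR⟩ := exists_nat_gt (|t| + 1)
    obtain ⟨C, hC, hCN⟩ := hN R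
    have hR' := abs_le.1 (show |t| ≤ R - 1 by linarith)
    have hbound : ∀ n : ℕ, ∫⁻ ω, ENNReal.ofReal ((N t ω - dyadicStep (N · ω) n t) ^ 2) ∂P ≤
        ENNReal.ofReal (C * (1 / 2) ^ n) := by
      intro n
      have h2 : (0 : ℝ) < 2 ^ n := by positivity
      have h2' : (1 : ℝ) ≤ 2 ^ n := one_le_pow₀ (by norm_num)
      set s : ℝ := ⌊(2 : ℝ) ^ n * t⌋ / 2 ^ n with hs
      have hst : s ≤ t := by
        rw [hs, div_le_iff₀ h2]
        linarith [Int.floor_le ((2 : ℝ) ^ n * t)]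
      have hts : t - s ≤ 1 / 2 ^ n := by
        rw [hs, sub_le_iff_le_add, ← add_div, le_div_iff₀ h2]
        linarith [Int.lt_floor_add_one ((2 : ℝ) ^ n * t)]
      have h1n : (1 : ℝ) / 2 ^ n ≤ 1 := (div_le_one h2).2 h2'
      change ∫⁻ ω, ENNReal.ofReal ((N t ω - N s ω) ^ 2) ∂P ≤ _
      rcases hst.eq_or_lt with h | h
      · rw [h]; simp
      · refine (hCN s t (by linarith [hR'.1]) h (by linarith [hR'.2])).trans ?_
        refine ENNReal.ofReal_le_ofReal (mul_le_mul_of_nonneg_left ?_ hC)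
        calc (t - s) ^ q ≤ (t - s) ^ (1 : ℝ) := Real.rpow_le_rpow_of_exponent_ge (sub_pos.2 h)
              (hts.trans h1n) hq.le
          _ ≤ (1 / 2) ^ n := by rw [Real.rpow_one, one_div_pow]; exact hts
    have hsum := ae_summable_of_tsum_lintegral_ne_top
      (f := fun n ω => (N t ω - dyadicStep (N · ω) n t) ^ 2)
      (fun n => ((hNm _).sub (hNm _)).pow_const 2) (fun _ _ => sq_nonneg _)
      (ne_top_of_le_ne_top (ENNReal.tsum_ofReal_const_mul_pow_ne_top (by norm_num : (0 : ℝ) ≤ 1 / 2)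
        (by norm_num) hC) (ENNReal.tsum_le_tsum hbound))
    filter_upwards [hG, hsum] with ω hω hsω
    have h1 := hM t ω
    simp only [indicator_of_mem hω] at h1
    have h2 := hsω.tendsto_atTop_zero
    have h3 : Tendsto (fun n => (N t ω - dyadicStep (N · ω) n t) ^ 2) atTop
      (𝓝 ((N t ω - M t ω) ^ 2)) := (h1.const_sub _).pow 2
    have h4 := tendsto_nhds_unique h3 h2
    linarith [pow_eq_zero_iff (two_ne_zero) |>.1 h4]

end

/-! ### Wiener integrals on ]-∞, t] as processes vanishing at -∞. -/

noncomputable section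

variable {d : ℕ} {H : ℝ} {P : Measure (FBmPath d)}

/-- `N` is a version of the process `t ↦ ∫_{-∞}^t g dB_j`. -/
structure IsWienerPrimitive (P : Measure (FBmPath d)) (g : ℝ → ℝ) (j : Fin d)
    (N : ℝ → FBmPath d → ℝ) : Prop where
  memLp : ∀ t, MemLp (N t) 2 P
  integral : ∀ s t, s < t → IsWienerIntegralComp P g j s t (fun ω => N t ω - N s ω)
  tendsto : Tendsto (fun s => eLpNorm (N s) 2 P) atBot (𝓝 0)

namespace IsWienerPrimitive

variable {g : ℝ → ℝ} {j : Fin d} {N N' : ℝ → FBmPath d → ℝ}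

/-- Almost surely N t - N' t = N s - N' s for each s < t, and the right side tends to zero in L² as
s → -∞. -/
theorem ae_eq (hP : IsFBmLaw H P) (hN : IsWienerPrimitive P g j N)
    (hN' : IsWienerPrimitive P g j N') (t : ℝ) : N t =ᵐ[P] N' t := by
  have h : eLpNorm (N t - N' t) 2 P ≤ 0 := by
    refine ge_of_tendsto (by simpa using hN.tendsto.add hN'.tendsto) ?_
    filter_upwards [eventually_lt_atBot t] with s hs
    refine (eLpNorm_congr_ae ?_).trans_le
      (eLpNorm_sub_le (hN.memLp s).1 (hN'.memLp s).1 (by norm_num))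
    filter_upwards [(hN.integral s t hs).ae_eq hP hs (hN'.integral s t hs)] with ω hω
    simp only [Pi.sub_apply]
    linarith
  have h4 := (eLpNorm_eq_zero_iff ((hN.memLp t).sub (hN'.memLp t)).1 (by norm_num)).1
    (le_antisymm h bot_le)
  filter_upwards [h4] with ω hω
  simpa [sub_eq_zero] using hω

theorem finset_sum (hP : IsFBmLaw H P) {ι : Type*} (S : Finset ι) (c : ι → ℝ) {g : ι → ℝ → ℝ}
    {N : ι → ℝ → FBmPath d → ℝ} (hN : ∀ i, IsWienerPrimitive P (g i) j (N i)) :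
    IsWienerPrimitive P (fun u => ∑ i ∈ S, c i * g i u) j
      (fun t ω => ∑ i ∈ S, c i * N i t ω) where
  memLp t := memLp_finsetSum _ fun i _ => ((hN i).memLp t).const_mul _
  integral s t hst := by
    simpa only [mul_sub, Finset.sum_sub_distrib] using
      IsWienerIntegralComp.finset_sum hP S c fun i => (hN i).integral s t hst
  tendsto := by
    have hlim : Tendsto (fun s => ∑ i ∈ S, ‖c i‖ₑ * eLpNorm (N i s) 2 P) atBot (𝓝 0) := by
      have : Tendsto (fun s => ∑ i ∈ S, ‖c i‖ₑ * eLpNorm (N i s) 2 P) atBot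
          (𝓝 (∑ i ∈ S, ‖c i‖ₑ * 0)) :=
        tendsto_finsetSum _ fun i _ => ENNReal.Tendsto.const_mul (hN i).tendsto (Or.inr (by simp))
      simpa using this
    refine tendsto_of_tendsto_of_tendsto_of_le_of_le tendsto_const_nhds hlim (fun _ => bot_le)
      fun s => ?_
    have heq : (fun ω => ∑ i ∈ S, c i * N i s ω) = ∑ i ∈ S, c i • N i s := by
      ext ω
      simp
    simp only
    rw [heq]
    refine (eLpNorm_sum_le (fun i _ => (((hN i).memLp s).const_smul _).1) (by norm_num)).trans ?_
    exact Finset.sum_le_sum fun i _ => (eLpNorm_const_smul _ _ _ _).le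

theorem comp_wienerShift [IsProbabilityMeasure P] (hP : IsFBmLaw H P) (hH : 0 < H)
    (hN : IsWienerPrimitive P g j N) (r : ℝ) :
    IsWienerPrimitive P (fun u => g (u + r)) j (fun t ω => N (t + r) (wienerShift (-r) ω)) where
  memLp t := (hN.memLp (t + r)).comp_measurePreserving (hP.measurePreserving_wienerShift hH (-r))
  integral s t hst := (hN.integral (s + r) (t + r) (by linarith)).comp_wienerShift hP hH
  tendsto := by
    refine (hN.tendsto.comp (tendsto_atBot_add_const_right _ r tendsto_id)).congr fun t => ?_
    exact (eLpNorm_comp_measurePreserving (hN.memLp (t + r)).1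
      (hP.measurePreserving_wienerShift hH (-r))).symm

theorem congr_ae (hN : IsWienerPrimitive P g j N) (h : ∀ t, N t =ᵐ[P] N' t) :
    IsWienerPrimitive P g j N' where
  memLp t := (memLp_congr_ae (h t)).1 (hN.memLp t)
  integral s t hst := (hN.integral s t hst).congr_ae ((h t).sub (h s))
  tendsto := hN.tendsto.congr fun s => eLpNorm_congr_ae (h s)

end IsWienerPrimitive

theorem IsFBmLaw.exists_wienerPrimitive [IsProbabilityMeasure P] (hP : IsFBmLaw H P)
    (hH : 1 / 2 < H) {g : ℝ → ℝ} (hg : Continuous g) {C m : ℝ} (hC : 0 ≤ C) (hm : 0 < m)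
    (hbd : ∀ u, |g u| ≤ C * Real.exp (m * u)) (j : Fin d) :
    ∃ N : ℝ → FBmPath d → ℝ, (∀ ω, Continuous fun t => N t ω) ∧ (∀ t, Measurable (N t)) ∧
      IsWienerPrimitive P g j N ∧
        ∀ t, eLpNorm (N t) 2 P ≤
          ENNReal.ofReal (C / (1 - Real.exp (-m)) * Real.exp (m * t)) := by
  have hH0 : 0 < H := by linarith
  have hβ := hP.hasSemivariation hH j
  obtain ⟨L, hL1, hL2⟩ := hβ.exists_primitive hH0 hg hC hm hbd
  have hLe : ∀ t, eLpNorm (L t) 2 P ≤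
      ENNReal.ofReal (C / (1 - Real.exp (-m)) * Real.exp (m * t)) := by
    intro t
    rw [← Lp.enorm_def, ← ofReal_norm]
    exact ENNReal.ofReal_le_ofReal (hL2 t)
  have hLp : IsWienerPrimitive P g j fun t => L t := by
    refine ⟨fun t => Lp.memLp _, fun s t hst => ?_, ?_⟩
    · refine (hP.isWienerIntegralComp_curveInt hH hg j hst).congr_ae ?_
      rw [← hL1 s t hst]
      exact Lp.coeFn_sub _ _
    · refine tendsto_of_tendsto_of_tendsto_of_le_of_le tendsto_const_nhds ?_ (fun _ => bot_le) hLe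
      rw [← ENNReal.ofReal_zero]
      refine ENNReal.tendsto_ofReal ?_
      simpa using (Real.tendsto_exp_atBot.comp (tendsto_id.const_mul_atBot hm)).const_mul
        (C / (1 - Real.exp (-m)))
  -- On [-R, R] the integrand is at most C e^{mR}, so increments of L have L² norm at most C
  -- e^{mR}(t - s)^H: the criterion applies with exponent 2H > 1.
  obtain ⟨M, hMc, hMm, hML⟩ := exists_continuous_modification (P := P)
    (N := fun t => (Lp.aestronglyMeasurable (L t)).mk)
    (fun t => (Lp.aestronglyMeasurable (L t)).stronglyMeasurable_mk.measurable)
    (q := 2 * H) (by linarith) fun R => by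
      refine ⟨(C * Real.exp (m * R)) ^ 2, by positivity, fun s t hs hst ht => ?_⟩
      have h1 : ‖L t - L s‖ ≤ C * Real.exp (m * R) * (t - s) ^ H := by
        rw [hL1 s t hst]
        refine hβ.norm_curveInt_le hH0 hst hg.continuousOn fun u hu => (hbd u).trans ?_
        have : u ≤ R := hu.2.trans ht
        gcongr
      have h2 : ∫⁻ ω, ENNReal.ofReal (((Lp.aestronglyMeasurable (L t)).mk _ ω -
          (Lp.aestronglyMeasurable (L s)).mk _ ω) ^ 2) ∂P = ENNReal.ofReal (‖L t - L s‖ ^ 2) := by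
        obtain ⟨V, hV⟩ : ∃ V, V = L t - L s := ⟨_, rfl⟩
        have hVs := Lp.coeFn_sub (L t) (L s)
        rw [← hV] at hVs ⊢
        have h3 : ENNReal.ofReal (‖V‖ ^ 2) = eLpNorm V 2 P ^ 2 := by
          rw [← Lp.enorm_def, ← ofReal_norm, ENNReal.ofReal_pow (norm_nonneg _)]
        rw [h3, eLpNorm_eq_lintegral_rpow_enorm_toReal (by norm_num) (by norm_num),
          ← ENNReal.rpow_natCast, ← ENNReal.rpow_mul]
        norm_num
        refine lintegral_congr_ae ?_
        filter_upwards [(Lp.aestronglyMeasurable (L t)).ae_eq_mk,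
          (Lp.aestronglyMeasurable (L s)).ae_eq_mk, hVs] with ω e1 e2 e3
        rw [e3, Pi.sub_apply, e1, e2, Real.enorm_eq_ofReal_abs,
          ← ENNReal.ofReal_pow (abs_nonneg _), sq_abs]
      rw [h2]
      refine ENNReal.ofReal_le_ofReal ((pow_le_pow_left₀ (norm_nonneg _) h1 2).trans_eq ?_)
      rw [mul_pow, ← Real.rpow_natCast ((t - s) ^ H), ← Real.rpow_mul (sub_pos.2 hst).le]
      congr 2
      push_cast
      ring
  have hLM : ∀ t, L t =ᵐ[P] M t := fun t =>
    (Lp.aestronglyMeasurable (L t)).ae_eq_mk.trans (hML t).symm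
  exact ⟨M, hMc, hMm, hLp.congr_ae hLM, fun t => (eLpNorm_congr_ae (hLM t)).symm.trans_le (hLe t)⟩

end

/-! ### Matrix exponentials and the Gaussian convolution Z. -/

noncomputable section

variable {d : ℕ}

section Matrix

variable (A M N : Matrix (Fin d) (Fin d) ℝ)

theorem semigroupExp_add (s t : ℝ) :
    semigroupExp A (s + t) = semigroupExp A s * semigroupExp A t := by
  rw [semigroupExp, add_smul]
  exact Matrix.exp_add_of_commute _ _ (((Commute.refl A).smul_left s).smul_right t)

theorem continuous_semigroupExp : Continuous (semigroupExp A) := by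
  open scoped Matrix.Norms.Operator in
  exact (NormedSpace.exp_continuous (𝔸 := Matrix (Fin d) (Fin d) ℝ)).comp (by fun_prop)

theorem matApply_apply (x : EuclideanSpace ℝ (Fin d)) (i : Fin d) :
    matApply M x i = ∑ k, M i k * x k := rfl

theorem matApply_mul (x : EuclideanSpace ℝ (Fin d)) :
    matApply (M * N) x = matApply M (matApply N x) := by
  simp [matApply]

theorem matApply_sub (x y : EuclideanSpace ℝ (Fin d)) :
    matApply M (x - y) = matApply M x - matApply M y := by
  simp [matApply]

theorem norm_matApply_le (x : EuclideanSpace ℝ (Fin d)) :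
    ‖matApply M x‖ ≤ matOpNorm M * ‖x‖ :=
  ContinuousLinearMap.le_opNorm _ _

theorem abs_apply_le_matOpNorm (i j : Fin d) : |M i j| ≤ matOpNorm M := by
  have h1 := norm_matApply_le M (EuclideanSpace.single j 1)
  have h2 := PiLp.norm_apply_le (matApply M (EuclideanSpace.single j 1)) i
  rw [matApply_apply] at h2
  simp at h1 h2
  exact h2.trans h1

theorem continuous_matApply :
    Continuous fun p : Matrix (Fin d) (Fin d) ℝ × EuclideanSpace ℝ (Fin d) => matApply p.1 p.2 := by
  have : (fun p : Matrix (Fin d) (Fin d) ℝ × EuclideanSpace ℝ (Fin d) => matApply p.1 p.2) =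
      fun p => WithLp.toLp 2 (fun i => ∑ k, p.1 i k * p.2 k) := by
    ext p i
    exact matApply_apply _ _ _
  rw [this]
  refine (PiLp.continuous_toLp 2 _).comp (continuous_pi fun i => continuous_finsetSum _ fun k _ => ?_)
  exact (continuous_fst.matrix_elem i k).mul (by fun_prop)

end Matrix

theorem exists_abs_le_of_periodic {f : ℝ → ℝ} {τ : ℝ} (hf : Continuous f)
    (hper : Function.Periodic f τ) (hτ : 0 < τ) : ∃ C, ∀ u, |f u| ≤ C := by
  obtain ⟨C, hC⟩ := (isCompact_Icc (a := (0 : ℝ)) (b := τ)).exists_bound_of_continuousOn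
    hf.continuousOn
  refine ⟨C, fun u => ?_⟩
  obtain ⟨v, hv, huv⟩ := hper.exists_mem_Ico₀ hτ u
  rw [huv]
  exact hC v ⟨hv.1, hv.2.le⟩

theorem lintegral_enorm_sq_eq {Ω F : Type*} [MeasurableSpace Ω] [NormedAddCommGroup F]
    {P : Measure Ω} (f : Ω → F) : ∫⁻ ω, ‖f ω‖ₑ ^ 2 ∂P = eLpNorm f 2 P ^ 2 := by
  rw [eLpNorm_eq_lintegral_rpow_enorm_toReal (by norm_num) (by norm_num),
    ← ENNReal.rpow_natCast, ← ENNReal.rpow_mul]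
  norm_num

variable {H : ℝ} {P : Measure (FBmPath d)}

theorem IsWienerIntegral.ae_eq (hP : IsFBmLaw H P) {h : ℝ → Matrix (Fin d) (Fin d) ℝ} {s t : ℝ}
    (hst : s < t) {J J' : FBmPath d → EuclideanSpace ℝ (Fin d)} (hJ : IsWienerIntegral P h s t J)
    (hJ' : IsWienerIntegral P h s t J') : J =ᵐ[P] J' := by
  obtain ⟨K, hK, hJK⟩ := hJ
  obtain ⟨K', hK', hJK'⟩ := hJ'
  have hKK : ∀ᵐ ω ∂P, ∀ i j, K i j ω = K' i j ω :=
    ae_all_iff.2 fun i => ae_all_iff.2 fun j => (hK i j).ae_eq hP hst (hK' i j)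
  filter_upwards [hJK, hJK', hKK] with ω h1 h2 h3
  ext i
  simp [h1, h2, h3]

theorem IsWienerIntegral.aestronglyMeasurable {h : ℝ → Matrix (Fin d) (Fin d) ℝ} {s t : ℝ}
    {J : FBmPath d → EuclideanSpace ℝ (Fin d)} (hJ : IsWienerIntegral P h s t J) :
    AEStronglyMeasurable J P := by
  obtain ⟨K, hK, hJK⟩ := hJ
  have hm : AEMeasurable (fun ω => WithLp.toLp 2 (fun i => ∑ j, K i j ω) :
      FBmPath d → EuclideanSpace ℝ (Fin d)) P :=
    (PiLp.continuous_toLp 2 _).measurable.comp_aemeasurable (aemeasurable_pi_lambda _ fun i =>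
      Finset.aemeasurable_fun_sum _ fun j _ => (hK i j).1.1.aemeasurable)
  refine hm.aestronglyMeasurable.congr ?_
  filter_upwards [hJK] with ω hω
  ext i
  simp [hω]

theorem IsWienerIntegralIic.ae_eq (hP : IsFBmLaw H P) {h : ℝ → Matrix (Fin d) (Fin d) ℝ} {t : ℝ}
    {J J' : FBmPath d → EuclideanSpace ℝ (Fin d)} (hJ : IsWienerIntegralIic P h t J)
    (hJ' : IsWienerIntegralIic P h t J') : J =ᵐ[P] J' := by
  obtain ⟨hJ2, I, hI, hlim⟩ := hJ
  obtain ⟨hJ2', I', hI', hlim'⟩ := hJ'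
  have h3 : eLpNorm (J - J') 2 P ≤ 0 := by
    refine ge_of_tendsto (by simpa using hlim.add hlim') ?_
    filter_upwards [eventually_gt_atTop (-t)] with r hr
    have hr' : -r < t := by linarith
    refine (eLpNorm_congr_ae ?_).trans_le (eLpNorm_sub_le
      (hJ2.1.sub (hI r hr').aestronglyMeasurable) (hJ2'.1.sub (hI' r hr').aestronglyMeasurable)
      (by norm_num))
    filter_upwards [(hI r hr').ae_eq hP hr' (hI' r hr')] with ω hω
    simp [hω]
  have h4 := (eLpNorm_eq_zero_iff (hJ2.sub hJ2').1 (by norm_num)).1 (le_antisymm h3 bot_le)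
  filter_upwards [h4] with ω hω
  simpa [sub_eq_zero] using hω

/-- The vector with components `∑ j, N i j`. -/
def rowSum (x : Fin d → Fin d → ℝ) : EuclideanSpace ℝ (Fin d) := WithLp.toLp 2 fun i => ∑ j, x i j

theorem rowSum_apply (x : Fin d → Fin d → ℝ) (i : Fin d) : rowSum x i = ∑ j, x i j := rfl

theorem continuous_rowSum : Continuous (rowSum (d := d)) :=
  (PiLp.continuous_toLp 2 _).comp (by fun_prop)

theorem rowSum_eq_sum (x : Fin d → Fin d → ℝ) :
    rowSum x = ∑ p : Fin d × Fin d, x p.1 p.2 • EuclideanSpace.single p.1 (1 : ℝ) := by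
  ext i
  rw [rowSum_apply, WithLp.ofLp_sum, Finset.sum_apply, Fintype.sum_prod_type, Finset.sum_comm]
  simp

theorem memLp_rowSum {N : Fin d → Fin d → FBmPath d → ℝ} (hN : ∀ i j, MemLp (N i j) 2 P) :
    MemLp (fun ω => rowSum fun i j => N i j ω) 2 P := by
  simp only [rowSum_eq_sum]
  refine memLp_finsetSum _ fun p _ => ?_
  refine (hN p.1 p.2).of_le ((hN p.1 p.2).1.smul_const _) (ae_of_all _ fun ω => ?_)
  simp [norm_smul]

theorem eLpNorm_rowSum_le {N : Fin d → Fin d → FBmPath d → ℝ} (hN : ∀ i j, MemLp (N i j) 2 P) :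
    eLpNorm (fun ω => rowSum fun i j => N i j ω) 2 P ≤
      ∑ p : Fin d × Fin d, eLpNorm (N p.1 p.2) 2 P := by
  have h : (fun ω => rowSum fun i j => N i j ω) = ∑ p : Fin d × Fin d,
      fun ω => N p.1 p.2 ω • EuclideanSpace.single p.1 (1 : ℝ) := by
    ext1 ω
    rw [rowSum_eq_sum, Finset.sum_apply]
  rw [h]
  refine (eLpNorm_sum_le (fun p _ => (hN p.1 p.2).1.smul_const _) (by norm_num)).trans
    (Finset.sum_le_sum fun p _ => (eLpNorm_congr_norm_ae (ae_of_all _ fun ω => ?_)).le)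
  simp [norm_smul]

theorem eLpNorm_matApply_le (M : Matrix (Fin d) (Fin d) ℝ)
    (f : FBmPath d → EuclideanSpace ℝ (Fin d)) :
    eLpNorm (fun ω => matApply M (f ω)) 2 P ≤ ENNReal.ofReal (matOpNorm M) * eLpNorm f 2 P :=
  eLpNorm_le_mul_eLpNorm_of_ae_le_mul (ae_of_all _ fun ω => norm_matApply_le M (f ω)) 2

theorem continuous_matApply_right (M : Matrix (Fin d) (Fin d) ℝ) : Continuous (matApply M) :=
  ContinuousLinearMap.continuous _

theorem Continuous.matApply {X : Type*} [TopologicalSpace X] {f : X → Matrix (Fin d) (Fin d) ℝ}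
    {g : X → EuclideanSpace ℝ (Fin d)} (hf : Continuous f) (hg : Continuous g) :
    Continuous fun x => matApply (f x) (g x) := by
  have h := continuous_matApply.comp (hf.prodMk hg)
  exact h

/-- The process `S(t) N(t)`, where `N` has the components `∑ j, N i j`. -/
def expRowSum (A : Matrix (Fin d) (Fin d) ℝ) (N : Fin d → Fin d → ℝ → FBmPath d → ℝ) (t : ℝ)
    (ω : FBmPath d) : EuclideanSpace ℝ (Fin d) :=
  matApply (semigroupExp A t) (rowSum fun i j => N i j t ω)

section ExpRowSum

variable {A : Matrix (Fin d) (Fin d) ℝ} {σ : ℝ → Matrix (Fin d) (Fin d) ℝ}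
  {N : Fin d → Fin d → ℝ → FBmPath d → ℝ}

theorem continuous_expRowSum (hN : ∀ i j ω, Continuous fun t => N i j t ω) (ω : FBmPath d) :
    Continuous fun t => expRowSum A N t ω :=
  (continuous_semigroupExp A).matApply
    (continuous_rowSum.comp (continuous_pi fun i => continuous_pi fun j => hN i j ω))

theorem measurable_expRowSum (hN : ∀ i j t, Measurable (N i j t)) (t : ℝ) :
    Measurable (expRowSum A N t) :=
  (continuous_matApply_right _).measurable.comp (continuous_rowSum.measurable.comp
    (measurable_pi_lambda _ fun i => measurable_pi_lambda _ fun j => hN i j t))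

theorem memLp_expRowSum (hN : ∀ i j t, MemLp (N i j t) 2 P) (t : ℝ) :
    MemLp (expRowSum A N t) 2 P := by
  have h := memLp_rowSum fun i j => hN i j t
  exact ⟨(continuous_matApply_right _).comp_aestronglyMeasurable h.1,
    (eLpNorm_matApply_le _ _).trans_lt (ENNReal.mul_lt_top ENNReal.ofReal_lt_top h.2)⟩

/-- The factorisation S(t - u)σ(u) = S(t)·S(-u)σ(u) removes t from the integrand, so a single family
of primitives N serves every t; the integral on [-r, t] differs from S(t)N(t) by S(t)N(-r). -/
theorem isWienerIntegralIic_expRowSum (hP : IsFBmLaw H P)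
    (hN : ∀ i j, IsWienerPrimitive P (fun u => (semigroupExp A (-u) * σ u) i j) j (N i j))
    (t : ℝ) : IsWienerIntegralIic P (fun s => semigroupExp A (t - s) * σ s) t
      (expRowSum A N t) := by
  refine ⟨memLp_expRowSum (fun i j => (hN i j).memLp) t, fun r ω => matApply (semigroupExp A t)
    ((rowSum fun i j => N i j t ω) - rowSum fun i j => N i j (-r) ω), fun r hr => ?_, ?_⟩
  · refine ⟨fun i j ω => ∑ k, semigroupExp A t i k * (N k j t ω - N k j (-r) ω),
      fun i j => ?_, ae_of_all _ fun ω i => ?_⟩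
    · have h1 := IsWienerIntegralComp.finset_sum hP Finset.univ (fun k => semigroupExp A t i k)
        fun k => (hN k j).integral (-r) t hr
      have h2 : (fun u => (semigroupExp A (t - u) * σ u) i j) =
          fun u => ∑ k, semigroupExp A t i k * (semigroupExp A (-u) * σ u) k j := by
        ext u
        rw [← Matrix.mul_apply, ← Matrix.mul_assoc, ← semigroupExp_add, sub_eq_add_neg]
      rw [h2]
      exact h1
    · rw [matApply_apply, Finset.sum_comm]
      refine Finset.sum_congr rfl fun k _ => ?_
      rw [← Finset.mul_sum, PiLp.sub_apply, Finset.sum_sub_distrib]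
      rfl
  · have h0 : Tendsto (fun s => ∑ p : Fin d × Fin d, eLpNorm (N p.1 p.2 s) 2 P) atBot (𝓝 0) := by
      simpa using tendsto_finsetSum (Finset.univ : Finset (Fin d × Fin d))
        fun p _ => (hN p.1 p.2).tendsto
    have h1 : Tendsto (fun r : ℝ => ENNReal.ofReal (matOpNorm (semigroupExp A t)) *
        ∑ p : Fin d × Fin d, eLpNorm (N p.1 p.2 (-r)) 2 P) atTop (𝓝 0) := by
      simpa using ENNReal.Tendsto.const_mul (h0.comp tendsto_neg_atTop_atBot)
        (Or.inr ENNReal.ofReal_ne_top)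
    refine tendsto_of_tendsto_of_tendsto_of_le_of_le tendsto_const_nhds h1 (fun _ => bot_le)
      fun r => ?_
    refine le_trans (le_of_eq_of_le ?_ (eLpNorm_matApply_le (semigroupExp A t)
      fun ω => rowSum fun i j => N i j (-r) ω))
      (mul_le_mul_right (eLpNorm_rowSum_le fun i j => (hN i j).memLp (-r)) _)
    simp only [expRowSum, matApply_sub, sub_sub_cancel]

/-- By periodicity of σ the translated integrand is S(-τ) times the original one. Uniqueness of
primitives then gives N(t + τ) ∘ θ_{-τ} = S(-τ)N(t), and S(t + τ)S(-τ) = S(t). -/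
theorem expRowSum_comp_wienerShift [IsProbabilityMeasure P] (hP : IsFBmLaw H P) (hH : 0 < H)
    {τ : ℝ} (hσ : Function.Periodic σ τ) (hNc : ∀ i j ω, Continuous fun t => N i j t ω)
    (hN : ∀ i j, IsWienerPrimitive P (fun u => (semigroupExp A (-u) * σ u) i j) j (N i j)) :
    ∀ᵐ ω ∂P, ∀ t, expRowSum A N (t + τ) (wienerShift (-τ) ω) = expRowSum A N t ω := by
  have hNshift : ∀ t, ∀ᵐ ω ∂P, ∀ i j, N i j (t + τ) (wienerShift (-τ) ω) =
      ∑ k, semigroupExp A (-τ) i k * N k j t ω := by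
    refine fun t => ae_all_iff.2 fun i => ae_all_iff.2 fun j => ?_
    have h1 := (hN i j).comp_wienerShift hP hH τ
    have h2 := IsWienerPrimitive.finset_sum hP Finset.univ (fun k => semigroupExp A (-τ) i k)
      fun k => hN k j
    have h3 : (fun u => (semigroupExp A (-(u + τ)) * σ (u + τ)) i j) =
        fun u => ∑ k, semigroupExp A (-τ) i k * (semigroupExp A (-u) * σ u) k j := by
      ext u
      rw [← Matrix.mul_apply, ← Matrix.mul_assoc, ← semigroupExp_add, hσ u, neg_add_rev]
    rw [h3] at h1
    exact h1.ae_eq hP h2 t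
  -- The exceptional set so far depends on t. Rational times and path continuity give one null set
  -- for all t, as the drift depends on the whole path.
  have hrat : ∀ᵐ ω ∂P, ∀ r : ℚ,
      expRowSum A N (r + τ) (wienerShift (-τ) ω) = expRowSum A N r ω := by
    refine ae_all_iff.2 fun r => ?_
    filter_upwards [hNshift r] with ω hω
    have h1 : (rowSum fun i j => N i j (r + τ) (wienerShift (-τ) ω)) =
        matApply (semigroupExp A (-τ)) (rowSum fun i j => N i j r ω) := by
      ext i
      rw [matApply_apply]
      simp only [rowSum_apply, hω, Finset.mul_sum]
      exact Finset.sum_comm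
    rw [expRowSum, expRowSum, h1, ← matApply_mul, ← semigroupExp_add, add_neg_cancel_right]
  filter_upwards [hrat] with ω hω
  refine congrFun (Rat.denseRange_cast.equalizer
    ((continuous_expRowSum hNc (wienerShift (-τ) ω)).comp (continuous_id.add continuous_const))
    (continuous_expRowSum hNc ω) ?_)
  ext1 r
  exact hω r

/-- The decay e^{-mS t} of S(t) exactly compensates the growth e^{mS t} of N(t). -/
theorem eLpNorm_expRowSum_le {cS mS : ℝ} (hcS : 0 < cS)
    (hS : ∀ t : ℝ, matOpNorm (semigroupExp A t) ≤ cS * Real.exp (-mS * t))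
    (hN2 : ∀ i j t, MemLp (N i j t) 2 P) {K : Fin d → ℝ}
    (hN : ∀ i j t, eLpNorm (N i j t) 2 P ≤ ENNReal.ofReal (K j * Real.exp (mS * t))) (t : ℝ) :
    eLpNorm (expRowSum A N t) 2 P ≤ ∑ p : Fin d × Fin d, ENNReal.ofReal (cS * K p.2) := by
  refine (eLpNorm_matApply_le _ _).trans ((mul_le_mul_right
    (eLpNorm_rowSum_le fun i j => hN2 i j t) _).trans ?_)
  rw [Finset.mul_sum]
  refine Finset.sum_le_sum fun p _ => ?_
  refine (mul_le_mul' (ENNReal.ofReal_le_ofReal (hS t)) (hN p.1 p.2 t)).trans_eq ?_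
  rw [← ENNReal.ofReal_mul (by positivity)]
  congr 1
  have : Real.exp (-mS * t) * Real.exp (mS * t) = 1 := by
    rw [← Real.exp_add]; simp
  linear_combination cS * K p.2 * this

end ExpRowSum

/-- The bound on S at time -u gives cS e^{mS u} for every real u, and σ, continuous and periodic, is
bounded. -/
theorem exists_bound_exp_mul {A : Matrix (Fin d) (Fin d) ℝ} {σ : ℝ → Matrix (Fin d) (Fin d) ℝ}
    (hσ : Continuous σ) {cS mS τ : ℝ} (hcS : 0 < cS) (hτ : 0 < τ)
    (hS : ∀ t : ℝ, matOpNorm (semigroupExp A t) ≤ cS * Real.exp (-mS * t))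
    (hσPer : Function.Periodic σ τ) (j : Fin d) :
    ∃ c : ℝ, 0 ≤ c ∧ ∀ i u, |(semigroupExp A (-u) * σ u) i j| ≤ c * Real.exp (mS * u) := by
  have hσb : ∀ k, ∃ C, ∀ u, |σ u k j| ≤ C := fun k =>
    exists_abs_le_of_periodic (hσ.matrix_elem k j) (fun u => by rw [hσPer u]) hτ
  choose C hC using hσb
  refine ⟨∑ k, cS * C k, Finset.sum_nonneg fun k _ =>
    mul_nonneg hcS.le ((abs_nonneg _).trans (hC k 0)), fun i u => ?_⟩
  rw [Matrix.mul_apply, Finset.sum_mul]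
  refine (Finset.abs_sum_le_sum_abs _ _).trans (Finset.sum_le_sum fun k _ => ?_)
  rw [abs_mul]
  have h1 := (abs_apply_le_matOpNorm (semigroupExp A (-u)) i k).trans (hS (-u))
  rw [neg_mul_neg] at h1
  calc _ ≤ cS * Real.exp (mS * u) * C k := mul_le_mul h1 (hC k u) (abs_nonneg _) (by positivity)
    _ = _ := by ring

/-- The Gaussian convolution `Z(t) = ∫_{-∞}^t S(t - s) σ(s) dB(s)` has a version with continuous
paths, which is bounded in `L²` and invariant under the Wiener shift by a period. -/
theorem exists_wienerConvolution [IsProbabilityMeasure P] (hP : IsFBmLaw H P) (hH : 1 / 2 < H)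
    (A : Matrix (Fin d) (Fin d) ℝ) {σ : ℝ → Matrix (Fin d) (Fin d) ℝ} (hσ : Continuous σ)
    {cS mS τ : ℝ} (hcS : 0 < cS) (hmS : 0 < mS) (hτ : 0 < τ)
    (hS : ∀ t : ℝ, matOpNorm (semigroupExp A t) ≤ cS * Real.exp (-mS * t))
    (hσPer : Function.Periodic σ τ) :
    ∃ Z : ℝ → FBmPath d → EuclideanSpace ℝ (Fin d),
      (∀ ω, Continuous fun t => Z t ω) ∧ (∀ t, Measurable (Z t)) ∧
      (∃ C : ℝ≥0∞, C < ∞ ∧ ∀ t, ∫⁻ ω, ‖Z t ω‖ₑ ^ 2 ∂P ≤ C) ∧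
      (∀ t, IsWienerIntegralIic P (fun s => semigroupExp A (t - s) * σ s) t (Z t)) ∧
      ∀ᵐ ω ∂P, ∀ t, Z (t + τ) (wienerShift (-τ) ω) = Z t ω := by
  choose c hc0 hc using fun j => exists_bound_exp_mul hσ hcS hτ hS hσPer j
  have hGc : Continuous fun u => semigroupExp A (-u) * σ u :=
    ((continuous_semigroupExp A).comp continuous_neg).matrix_mul hσ
  have hex := fun i j =>
    hP.exists_wienerPrimitive hH (hGc.matrix_elem i j) (hc0 j) hmS (hc j i) j
  choose N hNc hNm hNp hNb using hex
  have hN2 : ∀ i j t, MemLp (N i j t) 2 P := fun i j => (hNp i j).memLp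
  refine ⟨expRowSum A N, continuous_expRowSum hNc, measurable_expRowSum hNm, ?_,
    isWienerIntegralIic_expRowSum hP hNp,
    expRowSum_comp_wienerShift hP (by linarith) hσPer hNc hNp⟩
  refine ⟨(∑ p : Fin d × Fin d, ENNReal.ofReal (cS * (c p.2 / (1 - Real.exp (-mS))))) ^ 2,
    ENNReal.pow_lt_top (ENNReal.sum_lt_top.2 fun _ _ => ENNReal.ofReal_lt_top), fun t => ?_⟩
  rw [lintegral_enorm_sq_eq]
  exact pow_le_pow_left' (eLpNorm_expRowSum_le hcS hS hN2 hNb t) 2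

end

/-! ### The exponential kernel, pointwise and in weighted L¹. -/

noncomputable section

/-- Convolution with the exponential kernel on the half-line `]-∞, t]`. -/
def expKernel (m : ℝ) (g : ℝ → ℝ≥0∞) (t : ℝ) : ℝ≥0∞ :=
  ∫⁻ s in Iic t, ENNReal.ofReal (Real.exp (-m * (t - s))) * g s

/-- The weighted `L¹` norm with weight `e^{-ε|s|}`. -/
def expWeight (ε : ℝ) (g : ℝ → ℝ≥0∞) : ℝ≥0∞ :=
  ∫⁻ s, ENNReal.ofReal (Real.exp (-ε * |s|)) * g s

section ExpKernel

variable {m ε : ℝ} {g g' : ℝ → ℝ≥0∞}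

theorem expKernel_mono (h : ∀ s, g s ≤ g' s) (t : ℝ) : expKernel m g t ≤ expKernel m g' t :=
  lintegral_mono fun s => mul_le_mul_right (h s) _

theorem expKernel_const_mul (c : ℝ≥0∞) (hg : Measurable g) (t : ℝ) :
    expKernel m (fun s => c * g s) t = c * expKernel m g t := by
  rw [expKernel, expKernel, ← lintegral_const_mul _ (by fun_prop)]
  exact lintegral_congr fun s => mul_left_comm _ _ _

theorem expKernel_add (hg : Measurable g) (t : ℝ) :
    expKernel m (fun s => g s + g' s) t = expKernel m g t + expKernel m g' t := by
  simp only [expKernel, mul_add]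
  exact lintegral_add_left (by fun_prop) _

theorem lintegral_exp_Iic (hm : 0 < m) (t : ℝ) :
    ∫⁻ s in Iic t, ENNReal.ofReal (Real.exp (-m * (t - s))) = ENNReal.ofReal (1 / m) := by
  have h : ∀ s, Real.exp (-m * (t - s)) = Real.exp (-m * t) * Real.exp (m * s) := fun s => by
    rw [← Real.exp_add]; ring_nf
  rw [← ofReal_integral_eq_lintegral_ofReal _ (ae_of_all _ fun s => (Real.exp_pos _).le)]
  · simp_rw [h]
    rw [integral_const_mul, integral_exp_mul_Iic hm, mul_div_assoc', ← Real.exp_add]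
    simp
  · simp_rw [h]
    exact (integrableOn_exp_mul_Iic hm t).const_mul _

theorem lintegral_exp_Ici (hm : 0 < m) (s : ℝ) :
    ∫⁻ t in Ici s, ENNReal.ofReal (Real.exp (-m * (t - s))) = ENNReal.ofReal (1 / m) := by
  have h : ∀ t, Real.exp (-m * (t - s)) = Real.exp (m * s) * Real.exp (-m * t) := fun t => by
    rw [← Real.exp_add]; ring_nf
  rw [setLIntegral_congr Ioi_ae_eq_Ici.symm,
    ← ofReal_integral_eq_lintegral_ofReal _ (ae_of_all _ fun s => (Real.exp_pos _).le)]
  · simp_rw [h]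
    rw [integral_const_mul, integral_exp_mul_Ioi (neg_lt_zero.2 hm), mul_div_assoc', mul_neg,
      ← Real.exp_add]
    simp
  · simp_rw [h]
    exact (integrableOn_exp_mul_Ioi (neg_lt_zero.2 hm) s).const_mul _

theorem expKernel_const (hm : 0 < m) (c : ℝ≥0∞) (t : ℝ) :
    expKernel m (fun _ => c) t = ENNReal.ofReal (1 / m) * c := by
  rw [expKernel, lintegral_mul_const _ (by fun_prop), lintegral_exp_Iic hm]

theorem exp_neg_abs_le (hε : 0 ≤ ε) {s t : ℝ} (hst : s ≤ t) :
    Real.exp (-ε * |t|) ≤ Real.exp (-ε * |s|) * Real.exp (ε * (t - s)) := by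
  rw [← Real.exp_add]
  refine Real.exp_le_exp.2 ?_
  have : |s| ≤ |t| + (t - s) := by
    have := abs_sub_abs_le_abs_sub s t
    rw [abs_sub_comm, abs_of_nonneg (sub_nonneg.2 hst)] at this
    linarith
  nlinarith

theorem exp_kernel_le_weight (hε : 0 ≤ ε) (hεm : ε ≤ m) {s t : ℝ} (hst : s ≤ t) :
    Real.exp (-m * (t - s)) ≤ Real.exp (ε * |t|) * Real.exp (-ε * |s|) := by
  rw [← Real.exp_add]
  refine Real.exp_le_exp.2 ?_
  have h1 : |s| - |t| ≤ t - s := by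
    have := abs_sub_abs_le_abs_sub s t
    rwa [abs_sub_comm, abs_of_nonneg (sub_nonneg.2 hst)] at this
  nlinarith [mul_le_mul_of_nonneg_left h1 hε, mul_le_mul_of_nonneg_right hεm (sub_nonneg.2 hst)]

/-- Turns weighted L¹ control into control at every point t; the Picard scheme contracts in the
former and has to converge in the latter. -/
theorem expKernel_le_expWeight (hε : 0 ≤ ε) (hεm : ε ≤ m) (hg : Measurable g) (t : ℝ) :
    expKernel m g t ≤ ENNReal.ofReal (Real.exp (ε * |t|)) * expWeight ε g := by
  rw [expWeight, ← lintegral_const_mul _ (by fun_prop)]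
  refine (setLIntegral_mono' measurableSet_Iic fun s hs => ?_).trans (setLIntegral_le_lintegral _ _)
  rw [← mul_assoc, ← ENNReal.ofReal_mul (Real.exp_pos _).le]
  exact mul_le_mul_left (ENNReal.ofReal_le_ofReal (exp_kernel_le_weight hε hεm hs)) _

theorem measurable_expKernel_uncurry {Ω : Type*} [MeasurableSpace Ω] {g : Ω → ℝ → ℝ≥0∞}
    (hg : Measurable (Function.uncurry g)) :
    Measurable fun p : Ω × ℝ => expKernel m (g p.1) p.2 := by
  have h1 : ∀ p : Ω × ℝ, expKernel m (g p.1) p.2 = ∫⁻ s, {q : (Ω × ℝ) × ℝ | q.2 ≤ q.1.2}.indicator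
      (fun q => ENNReal.ofReal (Real.exp (-m * (q.1.2 - q.2))) * g q.1.1 q.2) (p, s) := by
    intro p
    rw [expKernel, ← lintegral_indicator measurableSet_Iic]
    rfl
  simp_rw [h1]
  refine Measurable.lintegral_prod_right' (Measurable.indicator ?_
    (measurableSet_le measurable_snd (by fun_prop)))
  exact (by fun_prop : Measurable fun q : (Ω × ℝ) × ℝ =>
    ENNReal.ofReal (Real.exp (-m * (q.1.2 - q.2)))).mul
      (hg.comp ((measurable_fst.comp measurable_fst).prodMk measurable_snd))

theorem measurable_expKernel_apply {Ω : Type*} [MeasurableSpace Ω] {g : ℝ → Ω → ℝ≥0∞}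
    (hg : Measurable (Function.uncurry g)) (t : ℝ) :
    Measurable fun ω => expKernel m (fun s => g s ω) t := by
  have hg' : Measurable (Function.uncurry fun ω s => g s ω) := hg.comp measurable_swap
  have h := (measurable_expKernel_uncurry (m := m) hg').comp (measurable_prodMk_right (y := t))
  exact h

theorem measurable_expKernel (hg : Measurable g) : Measurable (expKernel m g) :=
  (measurable_expKernel_uncurry (Ω := Unit) (g := fun _ => g) (hg.comp measurable_snd)).comp
    (measurable_prodMk_left (x := ()))

/-- Tonelli, after moving the weight from t to s: since |s| ≤ |t| + (t - s), this costs e^{ε(t-s)},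
which lowers the decay rate of the kernel from m to m - ε. -/
theorem expWeight_expKernel_le (hε : 0 ≤ ε) (hεm : ε < m) (hg : Measurable g) :
    expWeight ε (expKernel m g) ≤ ENNReal.ofReal (1 / (m - ε)) * expWeight ε g := by
  let f : ℝ → ℝ → ℝ≥0∞ := fun t s => {q : ℝ × ℝ | q.2 ≤ q.1}.indicator
    (fun q => ENNReal.ofReal (Real.exp (-ε * |q.1|)) *
      (ENNReal.ofReal (Real.exp (-m * (q.1 - q.2))) * g q.2)) (t, s)
  have hfm : Measurable (Function.uncurry f) := by
    refine Measurable.indicator ?_ (measurableSet_le measurable_snd measurable_fst)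
    exact (by fun_prop : Measurable fun q : ℝ × ℝ => ENNReal.ofReal (Real.exp (-ε * |q.1|))).mul
      ((by fun_prop : Measurable fun q : ℝ × ℝ =>
        ENNReal.ofReal (Real.exp (-m * (q.1 - q.2)))).mul (hg.comp measurable_snd))
  have h1 : expWeight ε (expKernel m g) = ∫⁻ t, ∫⁻ s, f t s := by
    refine lintegral_congr fun t => ?_
    rw [expKernel, ← lintegral_const_mul _ (by fun_prop), ← lintegral_indicator measurableSet_Iic]
    rfl
  rw [h1, lintegral_lintegral_swap hfm.aemeasurable, expWeight,
    ← lintegral_const_mul _ (by fun_prop)]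
  refine lintegral_mono fun s => ?_
  calc ∫⁻ t, f t s = ∫⁻ t in Ici s, ENNReal.ofReal (Real.exp (-ε * |t|)) *
        (ENNReal.ofReal (Real.exp (-m * (t - s))) * g s) := by
        rw [← lintegral_indicator measurableSet_Ici]
        rfl
    _ ≤ ∫⁻ t in Ici s, ENNReal.ofReal (Real.exp (-(m - ε) * (t - s))) *
        (ENNReal.ofReal (Real.exp (-ε * |s|)) * g s) := by
        refine setLIntegral_mono' measurableSet_Ici fun t ht => ?_
        rw [← mul_assoc, ← mul_assoc, ← ENNReal.ofReal_mul (Real.exp_pos _).le,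
          ← ENNReal.ofReal_mul (Real.exp_pos _).le]
        refine mul_le_mul_left (ENNReal.ofReal_le_ofReal ?_) _
        refine (mul_le_mul_of_nonneg_right (exp_neg_abs_le hε ht) (Real.exp_pos _).le).trans_eq ?_
        rw [mul_assoc, ← Real.exp_add, mul_comm]
        congr 2
        ring
    _ = _ := by
        rw [lintegral_mul_const _ (by fun_prop), lintegral_exp_Ici (sub_pos.2 hεm)]

theorem expWeight_mono (h : ∀ s, g s ≤ g' s) : expWeight ε g ≤ expWeight ε g' :=
  lintegral_mono fun s => mul_le_mul_right (h s) _

theorem expWeight_const_mul (c : ℝ≥0∞) (hg : Measurable g) :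
    expWeight ε (fun s => c * g s) = c * expWeight ε g := by
  rw [expWeight, expWeight, ← lintegral_const_mul _ (by fun_prop)]
  exact lintegral_congr fun s => mul_left_comm _ _ _

theorem expWeight_add (hg : Measurable g) :
    expWeight ε (fun s => g s + g' s) = expWeight ε g + expWeight ε g' := by
  simp only [expWeight, mul_add]
  exact lintegral_add_left (by fun_prop) _

theorem expWeight_tsum {g : ℕ → ℝ → ℝ≥0∞} (hg : ∀ n, Measurable (g n)) :
    expWeight ε (fun s => ∑' n, g n s) = ∑' n, expWeight ε (g n) := by
  simp only [expWeight]
  rw [← lintegral_tsum fun n => by fun_prop]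
  exact lintegral_congr fun s => ENNReal.tsum_mul_left.symm

theorem expWeight_const_lt_top (hε : 0 < ε) {c : ℝ≥0∞} (hc : c < ∞) :
    expWeight ε (fun _ => c) < ∞ := by
  rw [expWeight, lintegral_mul_const _ (by fun_prop)]
  refine ENNReal.mul_lt_top ?_ hc
  rw [← lintegral_add_compl _ (measurableSet_Iic (a := (0 : ℝ))), compl_Iic]
  refine ENNReal.add_lt_top.2 ⟨?_, ?_⟩
  · refine lt_of_le_of_lt ?_ (lt_of_eq_of_lt (lintegral_exp_Iic hε 0) ENNReal.ofReal_lt_top)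
    refine setLIntegral_mono' measurableSet_Iic fun s hs => ENNReal.ofReal_le_ofReal ?_
    rw [abs_of_nonpos hs, zero_sub]
  · refine lt_of_le_of_lt ?_ (lt_of_eq_of_lt (lintegral_exp_Ici hε 0) ENNReal.ofReal_lt_top)
    refine (setLIntegral_mono' measurableSet_Ioi fun s hs => ENNReal.ofReal_le_ofReal ?_).trans
      (lintegral_mono_set Ioi_subset_Ici_self)
    rw [abs_of_pos hs, sub_zero]

/-- Jensen's inequality for the probability density m e^{-m(t-s)} on ]-∞, t], obtained from
Cauchy–Schwarz with the kernel split into two square roots `k`. -/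
theorem expKernel_sq_le (hm : 0 < m) (hg : Measurable g) (t : ℝ) :
    (ENNReal.ofReal m * expKernel m g t) ^ 2 ≤
      ENNReal.ofReal m * expKernel m (fun s => g s ^ 2) t := by
  let k : ℝ → ℝ≥0∞ := fun s => ENNReal.ofReal (Real.exp (-m * (t - s) / 2))
  have hk : ∀ s, k s ^ 2 = ENNReal.ofReal (Real.exp (-m * (t - s))) := fun s => by
    rw [← ENNReal.ofReal_pow (Real.exp_pos _).le, ← Real.exp_nat_mul]
    congr 2
    push_cast
    ring
  have hkm : Measurable k := by fun_prop
  have h := ENNReal.lintegral_mul_le_Lp_mul_Lq (volume.restrict (Iic t))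
    Real.HolderConjugate.two_two hkm.aemeasurable (hkm.mul hg).aemeasurable
  simp only [Pi.mul_apply, ENNReal.rpow_two, mul_pow, hk, lintegral_exp_Iic hm, ← mul_assoc,
    ← sq] at h
  have h2 : expKernel m g t ^ 2 ≤
      ENNReal.ofReal (1 / m) * expKernel m (fun s => g s ^ 2) t := by
    refine (pow_le_pow_left' h 2).trans_eq ?_
    rw [mul_pow, ← ENNReal.rpow_natCast, ← ENNReal.rpow_natCast, ← ENNReal.rpow_mul,
      ← ENNReal.rpow_mul]
    norm_num
    simp only [expKernel, neg_mul]
  calc _ ≤ ENNReal.ofReal m ^ 2 * (ENNReal.ofReal (1 / m) * expKernel m (fun s => g s ^ 2) t) := by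
        rw [mul_pow]
        exact mul_le_mul_right h2 _
    _ = _ := by
        rw [← mul_assoc]
        congr 1
        rw [← ENNReal.ofReal_pow hm.le, ← ENNReal.ofReal_mul (by positivity)]
        congr 1
        field_simp

theorem lintegral_expKernel {Ω : Type*} [MeasurableSpace Ω] {P : Measure Ω} [SFinite P]
    {g : ℝ → Ω → ℝ≥0∞} (hg : Measurable (Function.uncurry g)) (t : ℝ) :
    ∫⁻ ω, expKernel m (fun s => g s ω) t ∂P = expKernel m (fun s => ∫⁻ ω, g s ω ∂P) t := by
  simp only [expKernel]
  rw [lintegral_lintegral_swap]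
  · refine lintegral_congr fun s => ?_
    exact lintegral_const_mul _ (hg.comp (measurable_const.prodMk measurable_id))
  · exact ((by fun_prop : Measurable fun q : Ω × ℝ =>
      ENNReal.ofReal (Real.exp (-m * (t - q.2)))).mul (hg.comp measurable_swap)).aemeasurable

theorem lintegral_expWeight {Ω : Type*} [MeasurableSpace Ω] {P : Measure Ω} [SFinite P]
    {g : ℝ → Ω → ℝ≥0∞} (hg : Measurable (Function.uncurry g)) :
    ∫⁻ ω, expWeight ε (fun s => g s ω) ∂P = expWeight ε (fun s => ∫⁻ ω, g s ω ∂P) := by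
  simp only [expWeight]
  rw [lintegral_lintegral_swap]
  · refine lintegral_congr fun s => ?_
    exact lintegral_const_mul _ (hg.comp (measurable_const.prodMk measurable_id))
  · exact ((by fun_prop : Measurable fun q : Ω × ℝ =>
      ENNReal.ofReal (Real.exp (-ε * |q.2|))).mul (hg.comp measurable_swap)).aemeasurable

theorem measurable_expWeight {Ω : Type*} [MeasurableSpace Ω]
    {g : ℝ → Ω → ℝ≥0∞} (hg : Measurable (Function.uncurry g)) :
    Measurable fun ω => expWeight ε (fun s => g s ω) := by
  refine Measurable.lintegral_prod_right' (f := fun q : Ω × ℝ =>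
    ENNReal.ofReal (Real.exp (-ε * |q.2|)) * g q.2 q.1) ?_
  exact (by fun_prop : Measurable fun q : Ω × ℝ =>
    ENNReal.ofReal (Real.exp (-ε * |q.2|))).mul (hg.comp measurable_swap)

end ExpKernel

end

/-! ### The drift operator and pathwise Picard iteration. -/

noncomputable section

variable {d : ℕ}

/-- The drift term `∫_{-∞}^t S(t - s) b(s, x(s)) ds` along a path `x`. -/
def drift (A : Matrix (Fin d) (Fin d) ℝ)
    (b : ℝ → EuclideanSpace ℝ (Fin d) → EuclideanSpace ℝ (Fin d))
    (x : ℝ → EuclideanSpace ℝ (Fin d)) (t : ℝ) : EuclideanSpace ℝ (Fin d) :=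
  ∫ s in Iic t, matApply (semigroupExp A (t - s)) (b s (x s))

/-- The standing assumptions on the drift. -/
structure DriftBounds (A : Matrix (Fin d) (Fin d) ℝ)
    (b : ℝ → EuclideanSpace ℝ (Fin d) → EuclideanSpace ℝ (Fin d)) (cS mS cb mb : ℝ) : Prop where
  continuous : Continuous fun p : ℝ × EuclideanSpace ℝ (Fin d) => b p.1 p.2
  cS_pos : 0 < cS
  mS_pos : 0 < mS
  cb_pos : 0 < cb
  mb_pos : 0 < mb
  exp_le : ∀ t : ℝ, matOpNorm (semigroupExp A t) ≤ cS * Real.exp (-mS * t)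
  lipschitz : ∀ (t : ℝ) (x y : EuclideanSpace ℝ (Fin d)), ‖b t x - b t y‖ ≤ cb * ‖x - y‖
  growth : ∀ (t : ℝ) (x : EuclideanSpace ℝ (Fin d)), ‖b t x‖ ≤ mb * (1 + ‖x‖)

namespace DriftBounds

variable {A : Matrix (Fin d) (Fin d) ℝ}
  {b : ℝ → EuclideanSpace ℝ (Fin d) → EuclideanSpace ℝ (Fin d)} {cS mS cb mb : ℝ}

theorem enorm_integrand_sub_le (h : DriftBounds A b cS mS cb mb) (s t : ℝ)
    (x y : EuclideanSpace ℝ (Fin d)) :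
    ‖matApply (semigroupExp A (t - s)) (b s x) - matApply (semigroupExp A (t - s)) (b s y)‖ₑ ≤
      ENNReal.ofReal (Real.exp (-mS * (t - s))) * (ENNReal.ofReal (cS * cb) * ‖x - y‖ₑ) := by
  rw [← matApply_sub, ← ofReal_norm, ← ofReal_norm,
    ← ENNReal.ofReal_mul (mul_pos h.cS_pos h.cb_pos).le, ← ENNReal.ofReal_mul (Real.exp_pos _).le]
  refine ENNReal.ofReal_le_ofReal ((norm_matApply_le _ _).trans ?_)
  have := h.cS_pos
  calc _ ≤ cS * Real.exp (-mS * (t - s)) * (cb * ‖x - y‖) :=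
        mul_le_mul (h.exp_le _) (h.lipschitz s x y) (norm_nonneg _) (by positivity)
    _ = _ := by ring

theorem enorm_integrand_le (h : DriftBounds A b cS mS cb mb) (s t : ℝ)
    (x : EuclideanSpace ℝ (Fin d)) :
    ‖matApply (semigroupExp A (t - s)) (b s x)‖ₑ ≤
      ENNReal.ofReal (Real.exp (-mS * (t - s))) *
        (ENNReal.ofReal (cS * mb) + ENNReal.ofReal (cS * cb) * ‖x‖ₑ) := by
  have h1 := h.cS_pos
  have h2 := h.cb_pos
  have h3 := h.mb_pos
  rw [← ofReal_norm, ← ofReal_norm, ← ENNReal.ofReal_mul (by positivity),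
    ← ENNReal.ofReal_add (by positivity) (by positivity), ← ENNReal.ofReal_mul (Real.exp_pos _).le]
  refine ENNReal.ofReal_le_ofReal ((norm_matApply_le _ _).trans ?_)
  -- The growth bound is used only at x = 0. The coefficient of ‖x‖ must be cb, not mb, because the
  -- smallness condition involves cb.
  have h4 : ‖b s x‖ ≤ mb + cb * ‖x‖ := by
    have e1 := h.growth s 0
    have e2 := h.lipschitz s x 0
    rw [norm_zero, add_zero, mul_one] at e1
    rw [sub_zero] at e2
    have e3 := norm_le_insert' (b s x) (b s 0)
    linarith
  calc _ ≤ cS * Real.exp (-mS * (t - s)) * (mb + cb * ‖x‖) :=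
        mul_le_mul (h.exp_le _) h4 (norm_nonneg _) (by positivity)
    _ = _ := by ring

theorem measurable_integrand {Ω : Type*} [MeasurableSpace Ω] (h : DriftBounds A b cS mS cb mb)
    {s t : Ω → ℝ} {x : Ω → EuclideanSpace ℝ (Fin d)} (hs : Measurable s) (ht : Measurable t)
    (hx : Measurable x) :
    Measurable fun ω => matApply (semigroupExp A (t ω - s ω)) (b (s ω) (x ω)) := by
  have hc : Continuous fun p : ℝ × ℝ × EuclideanSpace ℝ (Fin d) =>
      matApply (semigroupExp A (p.1 - p.2.1)) (b p.2.1 p.2.2) :=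
    ((continuous_semigroupExp A).comp (by fun_prop)).matApply (h.continuous.comp continuous_snd)
  have hcomp := hc.measurable.comp (ht.prodMk (hs.prodMk hx))
  exact hcomp

theorem integrableOn (h : DriftBounds A b cS mS cb mb) {ε : ℝ} (hε : 0 < ε) (hεm : ε ≤ mS)
    {x : ℝ → EuclideanSpace ℝ (Fin d)} (hx : Measurable x) (hw : expWeight ε (fun s => ‖x s‖ₑ) < ∞)
    (t : ℝ) : IntegrableOn (fun s => matApply (semigroupExp A (t - s)) (b s (x s))) (Iic t) := by
  refine ⟨(h.measurable_integrand measurable_id measurable_const hx).aestronglyMeasurable, ?_⟩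
  rw [HasFiniteIntegral]
  refine (lintegral_mono fun s => h.enorm_integrand_le s t (x s)).trans_lt ?_
  refine (expKernel_le_expWeight hε.le hεm (by fun_prop) t).trans_lt ?_
  refine ENNReal.mul_lt_top ENNReal.ofReal_lt_top ?_
  rw [expWeight_add measurable_const, expWeight_const_mul _ (by fun_prop)]
  exact ENNReal.add_lt_top.2 ⟨expWeight_const_lt_top hε ENNReal.ofReal_lt_top,
    ENNReal.mul_lt_top ENNReal.ofReal_lt_top hw⟩

theorem enorm_drift_le (h : DriftBounds A b cS mS cb mb) (x : ℝ → EuclideanSpace ℝ (Fin d))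
    (t : ℝ) : ‖drift A b x t‖ₑ ≤
      expKernel mS (fun s => ENNReal.ofReal (cS * mb) + ENNReal.ofReal (cS * cb) * ‖x s‖ₑ) t :=
  (enorm_integral_le_lintegral_enorm _).trans
    (lintegral_mono fun s => h.enorm_integrand_le s t (x s))

theorem enorm_drift_sub_le (h : DriftBounds A b cS mS cb mb)
    {x y : ℝ → EuclideanSpace ℝ (Fin d)} {t : ℝ}
    (hx : IntegrableOn (fun s => matApply (semigroupExp A (t - s)) (b s (x s))) (Iic t))
    (hy : IntegrableOn (fun s => matApply (semigroupExp A (t - s)) (b s (y s))) (Iic t)) :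
    ‖drift A b x t - drift A b y t‖ₑ ≤
      expKernel mS (fun s => ENNReal.ofReal (cS * cb) * ‖x s - y s‖ₑ) t := by
  rw [drift, drift, ← integral_sub hx hy]
  exact (enorm_integral_le_lintegral_enorm _).trans
    (lintegral_mono fun s => h.enorm_integrand_sub_le s t (x s) (y s))

theorem measurable_drift {Ω : Type*} [MeasurableSpace Ω] (h : DriftBounds A b cS mS cb mb)
    {X : ℝ → Ω → EuclideanSpace ℝ (Fin d)} (hX : Measurable (Function.uncurry X)) :
    Measurable (Function.uncurry fun t ω => drift A b (fun s => X s ω) t) := by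
  have h1 : (Function.uncurry fun t ω => drift A b (fun s => X s ω) t) = fun p : ℝ × Ω =>
      ∫ s, {q : (ℝ × Ω) × ℝ | q.2 ≤ q.1.1}.indicator (fun q =>
        matApply (semigroupExp A (q.1.1 - q.2)) (b q.2 (X q.2 q.1.2))) (p, s) := by
    ext1 p
    rw [Function.uncurry, drift, ← integral_indicator measurableSet_Iic]
    rfl
  rw [h1]
  refine (StronglyMeasurable.integral_prod_right' (Measurable.stronglyMeasurable ?_)).measurable
  refine Measurable.indicator ?_ (measurableSet_le measurable_snd (by fun_prop))
  exact h.measurable_integrand measurable_snd (measurable_fst.comp measurable_fst)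
    (hX.comp (measurable_snd.prodMk (measurable_snd.comp measurable_fst)))

/-- Taking S(t) out of the integral leaves the primitive of the locally integrable function
S(-s)b(s, x(s)), which is continuous. -/
theorem continuous_drift {x : ℝ → EuclideanSpace ℝ (Fin d)}
    (hx : ∀ t, IntegrableOn (fun s => matApply (semigroupExp A (t - s)) (b s (x s))) (Iic t)) :
    Continuous (drift A b x) := by
  let f : ℝ → EuclideanSpace ℝ (Fin d) := fun s => matApply (semigroupExp A (-s)) (b s (x s))
  have hclm : ∀ (M : Matrix (Fin d) (Fin d) ℝ) (t : ℝ), IntegrableOn f (Iic t) →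
      ∫ s in Iic t, matApply M (f s) = matApply M (∫ s in Iic t, f s) := fun M t hf =>
    (Matrix.toEuclideanCLM (n := Fin d) (𝕜 := ℝ) M).integral_comp_comm hf
  have hmul : ∀ t s, matApply (semigroupExp A (t - s)) (b s (x s)) =
      matApply (semigroupExp A t) (f s) := fun t s => by
    rw [← matApply_mul, ← semigroupExp_add, sub_eq_add_neg]
  have hf : ∀ t, IntegrableOn f (Iic t) := by
    intro t
    have h1 := (Matrix.toEuclideanCLM (n := Fin d) (𝕜 := ℝ) (semigroupExp A (-t))).integrable_comp
      (hx t)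
    refine h1.congr (ae_of_all _ fun s => ?_)
    change matApply _ (matApply _ _) = _
    rw [← matApply_mul, ← semigroupExp_add]
    simp only [f]
    congr 2
    ring
  have h1 : drift A b x = fun t => matApply (semigroupExp A t)
      ((∫ s in Iic (0 : ℝ), f s) + ∫ s in (0 : ℝ)..t, f s) := by
    ext1 t
    rw [drift]
    simp only [hmul]
    rw [hclm _ _ (hf t), ← intervalIntegral.integral_Iic_sub_Iic (hf 0) (hf t), add_sub_cancel]
  rw [h1]
  refine (continuous_semigroupExp A).matApply (continuous_const.add ?_)
  refine intervalIntegral.continuous_primitive (fun a c => ?_) 0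
  exact ⟨(hf c).mono_set Ioc_subset_Iic_self, (hf a).mono_set Ioc_subset_Iic_self⟩

end DriftBounds

theorem drift_add_period {A : Matrix (Fin d) (Fin d) ℝ}
    {b : ℝ → EuclideanSpace ℝ (Fin d) → EuclideanSpace ℝ (Fin d)} {τ : ℝ}
    (hb : ∀ x, Function.Periodic (fun t => b t x) τ) (x : ℝ → EuclideanSpace ℝ (Fin d)) (t : ℝ) :
    drift A b x (t + τ) = drift A b (fun s => x (s + τ)) t := by
  have h := (measurePreserving_add_right (volume : Measure ℝ) τ).setIntegral_preimage_emb
    (measurableEmbedding_addRight τ)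
    (fun s => matApply (semigroupExp A (t + τ - s)) (b s (x s))) (Iic (t + τ))
  rw [drift, ← h, drift]
  have hset : (fun s => s + τ) ⁻¹' Iic (t + τ) = Iic t := by
    ext s
    simp
  rw [hset]
  refine setIntegral_congr_fun measurableSet_Iic fun s _ => ?_
  rw [show b (s + τ) (x (s + τ)) = b s (x (s + τ)) from hb _ s, add_sub_add_right_eq_sub]

/-- The Picard iterates of the equation `x = drift x + z`. -/
def picard (A : Matrix (Fin d) (Fin d) ℝ)
    (b : ℝ → EuclideanSpace ℝ (Fin d) → EuclideanSpace ℝ (Fin d))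
    (z : ℝ → EuclideanSpace ℝ (Fin d)) : ℕ → ℝ → EuclideanSpace ℝ (Fin d)
  | 0, _ => 0
  | n + 1, t => drift A b (picard A b z n) t + z t

/-- The iterates are deterministic functionals of the noise path and commute with translation by τ,
so the invariance of Z passes to them and to their limit. -/
theorem picard_add_period {A : Matrix (Fin d) (Fin d) ℝ}
    {b : ℝ → EuclideanSpace ℝ (Fin d) → EuclideanSpace ℝ (Fin d)} {τ : ℝ}
    (hb : ∀ x, Function.Periodic (fun t => b t x) τ) (z : ℝ → EuclideanSpace ℝ (Fin d)) (n : ℕ)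
    (t : ℝ) : picard A b z n (t + τ) = picard A b (fun s => z (s + τ)) n t := by
  induction n generalizing t with
  | zero => rfl
  | succ n ih =>
    rw [picard, picard, drift_add_period hb]
    simp only [ih]

namespace DriftBounds

variable {A : Matrix (Fin d) (Fin d) ℝ}
  {b : ℝ → EuclideanSpace ℝ (Fin d) → EuclideanSpace ℝ (Fin d)} {cS mS cb mb : ℝ}

theorem measurable_picard {Ω : Type*} [MeasurableSpace Ω] (h : DriftBounds A b cS mS cb mb)
    {Z : ℝ → Ω → EuclideanSpace ℝ (Fin d)} (hZ : Measurable (Function.uncurry Z)) (n : ℕ) :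
    Measurable (Function.uncurry fun t ω => picard A b (fun s => Z s ω) n t) := by
  induction n with
  | zero => exact measurable_const
  | succ n ih => exact (h.measurable_drift ih).add hZ

theorem measurable_picard_path (h : DriftBounds A b cS mS cb mb)
    {z : ℝ → EuclideanSpace ℝ (Fin d)} (hz : Measurable z) (n : ℕ) :
    Measurable (picard A b z n) :=
  (h.measurable_picard (Ω := Unit) (Z := fun t _ => z t) (hz.comp measurable_fst) n).comp
    (measurable_prodMk_right (y := ()))

theorem expWeight_picard_lt_top (h : DriftBounds A b cS mS cb mb) {ε : ℝ} (hε : 0 < ε)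
    (hεm : ε < mS) {z : ℝ → EuclideanSpace ℝ (Fin d)} (hz : Measurable z)
    (hw : expWeight ε (fun s => ‖z s‖ₑ) < ∞) (n : ℕ) :
    expWeight ε (fun s => ‖picard A b z n s‖ₑ) < ∞ := by
  induction n with
  | zero => simp [picard, expWeight]
  | succ n ih =>
    have hm := h.measurable_picard_path hz n
    have hm1 : Measurable fun s =>
        ENNReal.ofReal (cS * mb) + ENNReal.ofReal (cS * cb) * ‖picard A b z n s‖ₑ := by fun_prop
    refine (expWeight_mono (fun s => (enorm_add_le _ _).trans
      (add_le_add_left (h.enorm_drift_le _ s) _))).trans_lt ?_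
    rw [expWeight_add (measurable_expKernel hm1)]
    refine ENNReal.add_lt_top.2 ⟨(expWeight_expKernel_le hε.le hεm hm1).trans_lt
      (ENNReal.mul_lt_top ENNReal.ofReal_lt_top ?_), hw⟩
    rw [expWeight_add measurable_const, expWeight_const_mul _ (by fun_prop)]
    exact ENNReal.add_lt_top.2 ⟨expWeight_const_lt_top hε ENNReal.ofReal_lt_top,
      ENNReal.mul_lt_top ENNReal.ofReal_lt_top ih⟩

theorem enorm_picard_sub_le (h : DriftBounds A b cS mS cb mb) {ε : ℝ} (hε : 0 < ε)
    (hεm : ε < mS) {z : ℝ → EuclideanSpace ℝ (Fin d)} (hz : Measurable z)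
    (hw : expWeight ε (fun s => ‖z s‖ₑ) < ∞) (n : ℕ) (t : ℝ) :
    ‖picard A b z (n + 2) t - picard A b z (n + 1) t‖ₑ ≤ expKernel mS
      (fun s => ENNReal.ofReal (cS * cb) * ‖picard A b z (n + 1) s - picard A b z n s‖ₑ) t := by
  have hi : ∀ n t, IntegrableOn
      (fun s => matApply (semigroupExp A (t - s)) (b s (picard A b z n s))) (Iic t) := fun n t =>
    h.integrableOn hε hεm.le (h.measurable_picard_path hz n)
      (h.expWeight_picard_lt_top hε hεm hz hw n) t
  have := h.enorm_drift_sub_le (hi (n + 1) t) (hi n t)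
  rwa [picard, show picard A b z (n + 1) t = drift A b (picard A b z n) t + z t from rfl,
    add_sub_add_right_eq_sub]

theorem expWeight_picard_sub_le (h : DriftBounds A b cS mS cb mb) {ε : ℝ} (hε : 0 < ε)
    (hεm : ε < mS) {z : ℝ → EuclideanSpace ℝ (Fin d)} (hz : Measurable z)
    (hw : expWeight ε (fun s => ‖z s‖ₑ) < ∞) (n : ℕ) :
    expWeight ε (fun s => ‖picard A b z (n + 1) s - picard A b z n s‖ₑ) ≤
      ENNReal.ofReal (cS * cb / (mS - ε)) ^ n * expWeight ε (fun s => ‖picard A b z 1 s‖ₑ) := by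
  induction n with
  | zero => simp [picard]
  | succ n ih =>
    have hm1 := h.measurable_picard_path hz n
    have hm2 := h.measurable_picard_path hz (n + 1)
    have hpos : 0 < mS - ε := sub_pos.2 hεm
    calc _ ≤ expWeight ε (expKernel mS (fun s => ENNReal.ofReal (cS * cb) *
          ‖picard A b z (n + 1) s - picard A b z n s‖ₑ)) :=
          expWeight_mono (h.enorm_picard_sub_le hε hεm hz hw n)
      _ ≤ ENNReal.ofReal (1 / (mS - ε)) * (ENNReal.ofReal (cS * cb) *
          expWeight ε (fun s => ‖picard A b z (n + 1) s - picard A b z n s‖ₑ)) := by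
          refine (expWeight_expKernel_le hε.le hεm (by fun_prop)).trans_eq ?_
          rw [expWeight_const_mul _ (by fun_prop)]
      _ = ENNReal.ofReal (cS * cb / (mS - ε)) *
          expWeight ε (fun s => ‖picard A b z (n + 1) s - picard A b z n s‖ₑ) := by
          rw [← mul_assoc, ← ENNReal.ofReal_mul (by positivity)]
          congr 2
          ring
      _ ≤ _ := by
          rw [pow_succ', mul_assoc]
          exact mul_le_mul_right ih _

/-- The Picard iterates converge pointwise to a solution of `x = drift x + z`. -/
theorem exists_tendsto_picard (h : DriftBounds A b cS mS cb mb) {ε : ℝ} (hε : 0 < ε)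
    (hεm : ε < mS) (hq : cS * cb < mS - ε) {z : ℝ → EuclideanSpace ℝ (Fin d)} (hz : Measurable z)
    (hw : expWeight ε (fun s => ‖z s‖ₑ) < ∞) :
    ∃ x : ℝ → EuclideanSpace ℝ (Fin d), (∀ t, Tendsto (fun n => picard A b z n t) atTop (𝓝 (x t))) ∧
      ∀ t, IntegrableOn (fun s => matApply (semigroupExp A (t - s)) (b s (x s))) (Iic t) ∧
        x t = drift A b x t + z t := by
  have hpos : 0 < mS - ε := sub_pos.2 hεm
  have hL : 0 < cS * cb := mul_pos h.cS_pos h.cb_pos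
  set q := ENNReal.ofReal (cS * cb / (mS - ε)) with hqdef
  set w := expWeight ε (fun s => ‖picard A b z 1 s‖ₑ) with hwdef
  have hwlt : w < ∞ := h.expWeight_picard_lt_top hε hεm hz hw 1
  have hq1 : q < 1 := by
    rw [hqdef, ENNReal.ofReal_lt_one]
    exact (div_lt_one hpos).2 hq
  have hgeom : ∑' n, q ^ n * w ≠ ∞ := by
    rw [ENNReal.tsum_mul_right, ENNReal.tsum_geometric]
    exact ENNReal.mul_ne_top (ENNReal.inv_ne_top.2 (tsub_pos_of_lt hq1).ne') hwlt.ne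
  have hm := h.measurable_picard_path hz
  let δ : ℕ → ℝ → ℝ≥0∞ := fun n s => ‖picard A b z (n + 1) s - picard A b z n s‖ₑ
  have hδm : ∀ n, Measurable (δ n) := fun n => ((hm (n + 1)).sub (hm n)).enorm
  have hδw : ∀ n, expWeight ε (δ n) ≤ q ^ n * w := h.expWeight_picard_sub_le hε hεm hz hw
  have hδ : ∀ n t, edist (picard A b z n t) (picard A b z n.succ t) ≤ δ n t := fun n t => by
    rw [edist_comm, edist_eq_enorm_sub]
  have hδsum : ∀ t, ∑' n, δ n t ≠ ∞ := by
    intro t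
    -- The term n = 0 is split off: only differences from n = 1 on are images under the kernel and
    -- hence bounded at each point.
    rw [tsum_eq_zero_add' ENNReal.summable]
    refine ENNReal.add_ne_top.2 ⟨enorm_ne_top, ?_⟩
    have hbound : ∀ n, δ (n + 1) t ≤
        (ENNReal.ofReal (Real.exp (ε * |t|)) * ENNReal.ofReal (cS * cb)) * (q ^ n * w) := by
      intro n
      refine (h.enorm_picard_sub_le hε hεm hz hw n t).trans
        ((expKernel_le_expWeight hε.le hεm.le ((hδm n).const_mul _) t).trans ?_)
      rw [expWeight_const_mul _ (hδm n), mul_assoc]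
      exact mul_le_mul_right (mul_le_mul_right (hδw n) _) _
    refine ne_top_of_le_ne_top ?_ (ENNReal.tsum_le_tsum hbound)
    rw [ENNReal.tsum_mul_left]
    exact ENNReal.mul_ne_top (ENNReal.mul_ne_top ENNReal.ofReal_ne_top ENNReal.ofReal_ne_top) hgeom
  have hex : ∀ t, ∃ y, Tendsto (fun n => picard A b z n t) atTop (𝓝 y) := fun t =>
    cauchySeq_tendsto_of_complete (cauchySeq_of_edist_le_of_tsum_ne_top _ (fun n => hδ n t)
      (hδsum t))
  choose x hx using hex
  have hxm : Measurable x := measurable_of_tendsto_metrizable hm (tendsto_pi_nhds.2 hx)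
  have htail : ∀ n s, ‖x s - picard A b z n s‖ₑ ≤ ∑' k, δ (n + k) s := fun n s => by
    rw [← edist_eq_enorm_sub, edist_comm]
    exact edist_le_tsum_of_edist_le_of_tendsto (fun n => δ n s) (fun n => hδ n s) (hx s) n
  have htailw : ∀ n, expWeight ε (fun s => ‖x s - picard A b z n s‖ₑ) ≤
      ∑' k, q ^ (k + n) * w := fun n => by
    refine (expWeight_mono (htail n)).trans ?_
    rw [expWeight_tsum fun k => hδm (n + k)]
    refine ENNReal.tsum_le_tsum fun k => ?_
    rw [add_comm]
    exact hδw (k + n)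
  have htail0 : Tendsto (fun n => ∑' k, q ^ (k + n) * w) atTop (𝓝 0) :=
    ENNReal.tendsto_sum_nat_add _ hgeom
  have hxw : expWeight ε (fun s => ‖x s‖ₑ) < ∞ := by
    have h0 := htailw 0
    simp only [picard, sub_zero, add_zero] at h0
    exact h0.trans_lt (lt_top_iff_ne_top.2 hgeom)
  have hxi := h.integrableOn hε hεm.le hxm hxw
  refine ⟨x, hx, fun t => ⟨hxi t, ?_⟩⟩
  have hlim : Tendsto (fun n => drift A b (picard A b z n) t) atTop (𝓝 (drift A b x t)) := by
    rw [tendsto_iff_edist_tendsto_0]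
    have h0 : Tendsto (fun n => (ENNReal.ofReal (Real.exp (ε * |t|)) * ENNReal.ofReal (cS * cb)) *
        ∑' k, q ^ (k + n) * w) atTop (𝓝 0) := by
      simpa using ENNReal.Tendsto.const_mul htail0
        (Or.inr (ENNReal.mul_ne_top ENNReal.ofReal_ne_top ENNReal.ofReal_ne_top))
    refine tendsto_of_tendsto_of_tendsto_of_le_of_le tendsto_const_nhds h0 (fun _ => bot_le)
      fun n => ?_
    simp only
    rw [edist_comm, edist_eq_enorm_sub]
    have hmn := hm n
    refine (h.enorm_drift_sub_le (hxi t) (h.integrableOn hε hεm.le (hm n)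
      (h.expWeight_picard_lt_top hε hεm hz hw n) t)).trans
        ((expKernel_le_expWeight hε.le hεm.le (by fun_prop) t).trans ?_)
    rw [expWeight_const_mul _ (by fun_prop), mul_assoc]
    exact mul_le_mul_right (mul_le_mul_right (htailw n) _) _
  exact tendsto_nhds_unique ((tendsto_add_atTop_iff_nat 1).2 (hx t))
    (hlim.add tendsto_const_nhds)

end DriftBounds

end

/-! ### Moment bounds, uniqueness, and construction of the periodic solution. -/

noncomputable section

theorem ENNReal.le_one_add_sq (a : ℝ≥0∞) : a ≤ 1 + a ^ 2 := by
  rcases le_total a 1 with h | h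
  · exact h.trans le_self_add
  · refine le_trans ?_ le_add_self
    rw [sq]
    exact le_mul_of_one_le_left' h

theorem ENNReal.sq_convex {p q : ℝ≥0∞} (hpq : p + q = 1) (a b : ℝ≥0∞) :
    (p * a + q * b) ^ 2 ≤ p * a ^ 2 + q * b ^ 2 := by
  simpa using ENNReal.rpow_arith_mean_le_arith_mean2_rpow p q a b hpq (p := 2) (by norm_num)

theorem ENNReal.add_sq_le_two_mul (a b : ℝ≥0∞) : (a + b) ^ 2 ≤ 2 * (a ^ 2 + b ^ 2) := by
  have h := ENNReal.rpow_add_le_mul_rpow_add_rpow a b (p := 2) (by norm_num)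
  norm_num at h
  exact h

variable {d : ℕ}

namespace DriftBounds

variable {A : Matrix (Fin d) (Fin d) ℝ}
  {b : ℝ → EuclideanSpace ℝ (Fin d) → EuclideanSpace ℝ (Fin d)} {cS mS cb mb : ℝ}

/-- With q = cS cb / mS and p = 1 - q, each iterate is at most q times an exponential average of the
previous one plus p·B, where B = p⁻¹(‖Z‖ + cS mb / mS). Squares are convex, so any bound for E B² is
preserved by the recursion: qD + pD = D. -/
theorem exists_lintegral_picard_le {Ω : Type*} [MeasurableSpace Ω] {P : Measure Ω}
    [IsProbabilityMeasure P] (h : DriftBounds A b cS mS cb mb) (hq : cS * cb / mS < 1)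
    {Z : ℝ → Ω → EuclideanSpace ℝ (Fin d)} (hZ : Measurable (Function.uncurry Z)) {C : ℝ≥0∞}
    (hC : C < ∞) (hZC : ∀ t, ∫⁻ ω, ‖Z t ω‖ₑ ^ 2 ∂P ≤ C) :
    ∃ D : ℝ≥0∞, D < ∞ ∧ ∀ n t, ∫⁻ ω, ‖picard A b (fun s => Z s ω) n t‖ₑ ^ 2 ∂P ≤ D := by
  have hL : 0 < cS * cb := mul_pos h.cS_pos h.cb_pos
  have hm := h.mS_pos
  have hq0 : 0 < cS * cb / mS := div_pos hL hm
  set q := ENNReal.ofReal (cS * cb / mS) with hqdef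
  set p := ENNReal.ofReal (1 - cS * cb / mS) with hpdef
  have hqp : q + p = 1 := by
    rw [hqdef, hpdef, ← ENNReal.ofReal_add hq0.le (sub_nonneg.2 hq.le)]
    simp
  have hp0 : p ≠ 0 := by
    rw [hpdef, ENNReal.ofReal_ne_zero_iff]
    linarith
  have hpt : p ≠ ∞ := ENNReal.ofReal_ne_top
  set c := ENNReal.ofReal (1 / mS) * ENNReal.ofReal (cS * mb) with hc
  have hct : c < ∞ := ENNReal.mul_lt_top ENNReal.ofReal_lt_top ENNReal.ofReal_lt_top
  have hZt : ∀ t, Measurable (Z t) := fun t => hZ.comp measurable_prodMk_left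
  let B : ℝ → Ω → ℝ≥0∞ := fun t ω => p⁻¹ * (‖Z t ω‖ₑ + c)
  refine ⟨p⁻¹ ^ 2 * (2 * (C + c ^ 2)), ?_, fun n => ?_⟩
  · exact ENNReal.mul_lt_top (ENNReal.pow_lt_top (ENNReal.inv_lt_top.2 (pos_iff_ne_zero.2 hp0)))
      (ENNReal.mul_lt_top (by norm_num) (ENNReal.add_lt_top.2 ⟨hC, ENNReal.pow_lt_top hct⟩))
  have hB : ∀ t, ∫⁻ ω, B t ω ^ 2 ∂P ≤ p⁻¹ ^ 2 * (2 * (C + c ^ 2)) := by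
    intro t
    have hZm := hZt t
    calc ∫⁻ ω, B t ω ^ 2 ∂P ≤ ∫⁻ ω, p⁻¹ ^ 2 * (2 * (‖Z t ω‖ₑ ^ 2 + c ^ 2)) ∂P := by
          refine lintegral_mono fun ω => ?_
          simp only [B]
          rw [mul_pow]
          exact mul_le_mul_right (ENNReal.add_sq_le_two_mul _ _) _
      _ = p⁻¹ ^ 2 * (2 * (∫⁻ ω, ‖Z t ω‖ₑ ^ 2 ∂P + c ^ 2)) := by
          rw [lintegral_const_mul _ (by fun_prop), lintegral_const_mul _ (by fun_prop),
            lintegral_add_right _ measurable_const, lintegral_const, measure_univ, mul_one]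
      _ ≤ _ := by gcongr; exact hZC t
  induction n with
  | zero => intro t; simp [picard]
  | succ n ih =>
    intro t
    have hX := h.measurable_picard hZ n
    have hXω : ∀ ω, Measurable (picard A b (fun s => Z s ω) n) := fun ω =>
      hX.comp (measurable_prodMk_right (y := ω))
    have hX2 : Measurable (Function.uncurry fun s ω => ‖picard A b (fun s => Z s ω) n s‖ₑ ^ 2) :=
      hX.enorm.pow_const 2
    have hpt : ∀ ω, ‖picard A b (fun s => Z s ω) (n + 1) t‖ₑ ^ 2 ≤
        q * (ENNReal.ofReal mS * expKernel mS
          (fun s => ‖picard A b (fun s => Z s ω) n s‖ₑ ^ 2) t) + p * B t ω ^ 2 := by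
      intro ω
      have hω := hXω ω
      have h1 : ‖picard A b (fun s => Z s ω) (n + 1) t‖ₑ ≤ q * (ENNReal.ofReal mS * expKernel mS
          (fun s => ‖picard A b (fun s => Z s ω) n s‖ₑ) t) + p * B t ω := by
        refine (enorm_add_le _ _).trans ((add_le_add_left (h.enorm_drift_le _ t) _).trans_eq ?_)
        rw [expKernel_add measurable_const, expKernel_const hm,
          expKernel_const_mul _ (by fun_prop)]
        simp only [B]
        rw [← mul_assoc p, ENNReal.mul_inv_cancel hp0 hpt, one_mul, ← mul_assoc q, hqdef,
          ← ENNReal.ofReal_mul hq0.le, div_mul_cancel₀ _ hm.ne', ← hc]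
        ring
      refine (pow_le_pow_left' h1 2).trans ((ENNReal.sq_convex hqp _ _).trans ?_)
      gcongr
      exact expKernel_sq_le hm (by fun_prop) t
    have hKm : Measurable fun ω => expKernel mS
        (fun s => ‖picard A b (fun s => Z s ω) n s‖ₑ ^ 2) t :=
      measurable_expKernel_apply hX2 t
    have hBm : Measurable fun ω => B t ω ^ 2 := by
      have := hZt t
      fun_prop
    calc _ ≤ _ := lintegral_mono hpt
      _ = q * (ENNReal.ofReal mS * expKernel mS
          (fun s => ∫⁻ ω, ‖picard A b (fun s => Z s ω) n s‖ₑ ^ 2 ∂P) t) +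
            p * ∫⁻ ω, B t ω ^ 2 ∂P := by
          rw [lintegral_add_left (by fun_prop), lintegral_const_mul _ (by fun_prop),
            lintegral_const_mul _ hKm, lintegral_const_mul _ hBm, lintegral_expKernel hX2]
      _ ≤ q * (ENNReal.ofReal mS * expKernel mS (fun _ => p⁻¹ ^ 2 * (2 * (C + c ^ 2))) t) +
            p * (p⁻¹ ^ 2 * (2 * (C + c ^ 2))) :=
          add_le_add (mul_le_mul_right (mul_le_mul_right (expKernel_mono ih t) _) _)
            (mul_le_mul_right (hB t) _)
      _ = p⁻¹ ^ 2 * (2 * (C + c ^ 2)) := by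
          rw [expKernel_const hm, ← mul_assoc (ENNReal.ofReal mS),
            ← ENNReal.ofReal_mul hm.le, mul_one_div_cancel hm.ne', ENNReal.ofReal_one, one_mul,
            ← add_mul, hqp, one_mul]

/-- Two mild solutions that are bounded in `L²` are modifications of each other. -/
theorem ae_eq_of_mild {Ω : Type*} [MeasurableSpace Ω] {P : Measure Ω} [IsProbabilityMeasure P]
    (h : DriftBounds A b cS mS cb mb) (hq : cS * cb / mS < 1)
    {X Y Z : ℝ → Ω → EuclideanSpace ℝ (Fin d)} (hXm : Measurable (Function.uncurry X))
    (hYm : Measurable (Function.uncurry Y)) {C D : ℝ≥0∞} (hC : C < ∞) (hD : D < ∞)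
    (hXC : ∀ t, ∫⁻ ω, ‖X t ω‖ₑ ^ 2 ∂P ≤ C) (hYD : ∀ t, ∫⁻ ω, ‖Y t ω‖ₑ ^ 2 ∂P ≤ D)
    (hX : ∀ t, ∀ᵐ ω ∂P,
      IntegrableOn (fun s => matApply (semigroupExp A (t - s)) (b s (X s ω))) (Iic t) ∧
        X t ω = drift A b (fun s => X s ω) t + Z t ω)
    (hY : ∀ t, ∀ᵐ ω ∂P,
      IntegrableOn (fun s => matApply (semigroupExp A (t - s)) (b s (Y s ω))) (Iic t) ∧
        Y t ω = drift A b (fun s => Y s ω) t + Z t ω) (t : ℝ) : X t =ᵐ[P] Y t := by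
  have hL : 0 < cS * cb := mul_pos h.cS_pos h.cb_pos
  have hm := h.mS_pos
  let δ : ℝ → ℝ≥0∞ := fun t => ∫⁻ ω, ‖X t ω - Y t ω‖ₑ ∂P
  have hXt : ∀ t, Measurable (X t) := fun t => hXm.comp measurable_prodMk_left
  have hYt : ∀ t, Measurable (Y t) := fun t => hYm.comp measurable_prodMk_left
  have hsub : Measurable (Function.uncurry fun s ω => ‖X s ω - Y s ω‖ₑ) := (hXm.sub hYm).enorm
  -- Finiteness of sup δ is what allows sup δ ≤ q sup δ, with q < 1, to force sup δ = 0.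
  have hδtop : ∀ t, δ t ≤ (1 + C) + (1 + D) := by
    intro t
    have e1 := hXt t
    have e2 := hYt t
    calc δ t ≤ ∫⁻ ω, (1 + ‖X t ω‖ₑ ^ 2) + (1 + ‖Y t ω‖ₑ ^ 2) ∂P :=
          lintegral_mono fun ω => (enorm_sub_le).trans
            (add_le_add (ENNReal.le_one_add_sq _) (ENNReal.le_one_add_sq _))
      _ = (1 + ∫⁻ ω, ‖X t ω‖ₑ ^ 2 ∂P) + (1 + ∫⁻ ω, ‖Y t ω‖ₑ ^ 2 ∂P) := by
          rw [lintegral_add_left (by fun_prop), lintegral_add_left (by fun_prop),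
            lintegral_add_left (by fun_prop), lintegral_one, measure_univ]
      _ ≤ _ := by gcongr; exacts [hXC t, hYD t]
  have hδ : ∀ t, δ t ≤ ENNReal.ofReal (cS * cb) * expKernel mS δ t := by
    intro t
    have hδm : Measurable δ := hsub.lintegral_prod_right'
    rw [← expKernel_const_mul _ hδm]
    have h1 : ∀ s, ENNReal.ofReal (cS * cb) * δ s =
        ∫⁻ ω, ENNReal.ofReal (cS * cb) * ‖X s ω - Y s ω‖ₑ ∂P := fun s =>
      (lintegral_const_mul _ (hsub.comp measurable_prodMk_left)).symm
    simp only [h1]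
    rw [← lintegral_expKernel (g := fun s ω => ENNReal.ofReal (cS * cb) * ‖X s ω - Y s ω‖ₑ)
      (hsub.const_mul _)]
    refine lintegral_mono_ae ?_
    filter_upwards [hX t, hY t] with ω hXω hYω
    rw [hXω.2, hYω.2, add_sub_add_right_eq_sub]
    exact h.enorm_drift_sub_le hXω.1 hYω.1
  have hsup : (⨆ s, δ s) ≤ ENNReal.ofReal (cS * cb / mS) * ⨆ s, δ s := by
    refine iSup_le fun t => (hδ t).trans ?_
    refine (mul_le_mul_right (expKernel_mono (fun s => le_iSup δ s) t) _).trans_eq ?_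
    rw [expKernel_const hm, ← mul_assoc, ← ENNReal.ofReal_mul hL.le, mul_one_div]
  have hsup0 : (⨆ s, δ s) = 0 := by
    by_contra hne
    have htop : (⨆ s, δ s) ≠ ∞ := ne_top_of_le_ne_top
      (ENNReal.add_ne_top.2 ⟨ENNReal.add_ne_top.2 ⟨ENNReal.one_ne_top, hC.ne⟩,
        ENNReal.add_ne_top.2 ⟨ENNReal.one_ne_top, hD.ne⟩⟩) (iSup_le hδtop)
    refine absurd hsup (not_le.2 ?_)
    calc _ < 1 * ⨆ s, δ s := ENNReal.mul_lt_mul_left hne htop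
            (ENNReal.ofReal_lt_one.2 hq)
      _ = _ := one_mul _
  have h0 : δ t = 0 := le_antisymm ((le_iSup δ t).trans hsup0.le) bot_le
  filter_upwards [(lintegral_eq_zero_iff (hsub.comp measurable_prodMk_left)).1 h0] with ω hω
  exact sub_eq_zero.1 (enorm_eq_zero.1 hω)

end DriftBounds

/-- Existence: the limits of the Picard iterates along the paths of a stationary noise. -/
theorem exists_periodic_solution {H : ℝ} {P : Measure (FBmPath d)} [IsProbabilityMeasure P]
    (hP : IsFBmLaw H P) (hH : 0 < H) {A : Matrix (Fin d) (Fin d) ℝ}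
    {b : ℝ → EuclideanSpace ℝ (Fin d) → EuclideanSpace ℝ (Fin d)} {cS mS cb mb τ : ℝ}
    (h : DriftBounds A b cS mS cb mb) (hq : cS * cb / mS < 1)
    (hbPer : ∀ x : EuclideanSpace ℝ (Fin d), Function.Periodic (fun t => b t x) τ)
    {Z : ℝ → FBmPath d → EuclideanSpace ℝ (Fin d)} (hZc : ∀ ω, Continuous fun t => Z t ω)
    (hZm : ∀ t, Measurable (Z t)) {C : ℝ≥0∞} (hC : C < ∞)
    (hZC : ∀ t, ∫⁻ ω, ‖Z t ω‖ₑ ^ 2 ∂P ≤ C)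
    (hZτ : ∀ᵐ ω ∂P, ∀ t, Z (t + τ) (wienerShift (-τ) ω) = Z t ω) :
    ∃ X : ℝ → FBmPath d → EuclideanSpace ℝ (Fin d),
      Measurable (Function.uncurry X) ∧ (∀ ω, Continuous (fun t => X t ω)) ∧
        IsL2Bounded P X ∧ IsThetaPeriodic P τ X ∧
        ∀ t, ∀ᵐ ω ∂P,
          IntegrableOn (fun s => matApply (semigroupExp A (t - s)) (b s (X s ω))) (Iic t) ∧
            X t ω = drift A b (fun s => X s ω) t + Z t ω := by
  have hL : 0 < cS * cb := mul_pos h.cS_pos h.cb_pos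
  have hm := h.mS_pos
  have hLm : cS * cb < mS := (div_lt_one hm).1 hq
  -- This room makes the weighted contraction constant cS cb / (mS - ε) still less than 1.
  obtain ⟨ε, hε, hε2⟩ : ∃ ε, 0 < ε ∧ ε < mS - cS * cb := exists_between (sub_pos.2 hLm)
  have hεm : ε < mS := by linarith
  have hqε : cS * cb < mS - ε := by linarith
  have hZu : Measurable (Function.uncurry Z) :=
    measurable_uncurry_of_continuous_of_measurable hZc hZm
  let G : Set (FBmPath d) := {ω | expWeight ε (fun s => ‖Z s ω‖ₑ) < ∞}
  have hGm : MeasurableSet G := measurableSet_lt (measurable_expWeight hZu.enorm) measurable_const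
  -- The uniform L² bound gives a uniform L¹ bound, so the weighted norm of the paths of Z has
  -- finite expectation.
  have hG : ∀ᵐ ω ∂P, ω ∈ G := by
    refine ae_lt_top (measurable_expWeight hZu.enorm) (ne_of_lt ?_)
    rw [lintegral_expWeight (g := fun s ω => ‖Z s ω‖ₑ) hZu.enorm]
    refine (expWeight_mono fun s => ?_).trans_lt
      (expWeight_const_lt_top hε (ENNReal.add_lt_top.2 ⟨ENNReal.one_lt_top, hC⟩))
    refine (lintegral_mono fun ω => ENNReal.le_one_add_sq _).trans ?_
    rw [lintegral_add_left measurable_const, lintegral_one, measure_univ]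
    exact add_le_add_right (hZC s) 1
  have hex : ∀ ω, ∃ x : ℝ → EuclideanSpace ℝ (Fin d),
      (ω ∈ G → (∀ t, Tendsto (fun n => picard A b (fun s => Z s ω) n t) atTop (𝓝 (x t))) ∧
        ∀ t, IntegrableOn (fun s => matApply (semigroupExp A (t - s)) (b s (x s))) (Iic t) ∧
          x t = drift A b x t + Z t ω) ∧ (ω ∉ G → x = fun _ => 0) := by
    intro ω
    by_cases hω : ω ∈ G
    · obtain ⟨x, hx⟩ := h.exists_tendsto_picard hε hεm hqε (hZc ω).measurable hω
      exact ⟨x, fun _ => hx, fun hn => absurd hω hn⟩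
    · exact ⟨fun _ => 0, fun hn => absurd hn hω, fun _ => rfl⟩
  choose x hxG hxn using hex
  have hXlim : ∀ t ω, Tendsto (fun n => G.indicator
      (fun ω => picard A b (fun s => Z s ω) n t) ω) atTop (𝓝 (x ω t)) := by
    intro t ω
    by_cases hω : ω ∈ G
    · simp only [indicator_of_mem hω]
      exact (hxG ω hω).1 t
    · simp only [indicator_of_notMem hω, hxn ω hω]
      exact tendsto_const_nhds
  have hpm : ∀ n t, Measurable fun ω => picard A b (fun s => Z s ω) n t := fun n t =>
    (h.measurable_picard hZu n).comp measurable_prodMk_left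
  have hXm : ∀ t, Measurable fun ω => x ω t := fun t =>
    measurable_of_tendsto_metrizable (fun n => (hpm n t).indicator hGm)
      (tendsto_pi_nhds.2 (hXlim t))
  have hXc : ∀ ω, Continuous (x ω) := by
    intro ω
    by_cases hω : ω ∈ G
    · have h1 := (hxG ω hω).2
      have h2 : x ω = fun t => drift A b (x ω) t + Z t ω := funext fun t => (h1 t).2
      -- Path continuity comes from the fixed point equation itself: both the drift and Z are
      -- continuous.
      rw [h2]
      exact (DriftBounds.continuous_drift fun t => (h1 t).1).add (hZc ω)
    · rw [hxn ω hω]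
      exact continuous_const
  refine ⟨fun t ω => x ω t, measurable_uncurry_of_continuous_of_measurable hXc hXm, hXc, ?_, ?_, ?_⟩
  · obtain ⟨D, hD, hpD⟩ := h.exists_lintegral_picard_le hq hZu hC hZC
    refine ⟨D, hD, fun t => ?_⟩
    calc ∫⁻ ω, ‖x ω t‖ₑ ^ 2 ∂P =
          ∫⁻ ω, liminf (fun n => ‖picard A b (fun s => Z s ω) n t‖ₑ ^ 2) atTop ∂P := by
          refine lintegral_congr_ae ?_
          filter_upwards [hG] with ω hω
          exact (ENNReal.Tendsto.pow ((hxG ω hω).1 t).enorm).liminf_eq.symm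
      _ ≤ liminf (fun n => ∫⁻ ω, ‖picard A b (fun s => Z s ω) n t‖ₑ ^ 2 ∂P) atTop :=
          lintegral_liminf_le fun n => (hpm n t).enorm.pow_const 2
      _ ≤ D := by
          refine (liminf_le_liminf (Eventually.of_forall fun n => hpD n t)).trans_eq ?_
          exact liminf_const D
  · intro t
    -- The iterates must converge along θ_{-τ}ω as well as along ω; measure preservation puts both
    -- in G almost surely.
    have hGθ := (hP.measurePreserving_wienerShift hH (-τ)).quasiMeasurePreserving.ae hG
    filter_upwards [hG, hGθ, hZτ] with ω h1 h2 h3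
    refine tendsto_nhds_unique ((hxG _ h2).1 (t + τ)) (((hxG _ h1).1 t).congr fun n => ?_)
    rw [picard_add_period hbPer]
    simp only [h3]
  · intro t
    filter_upwards [hG] with ω hω using (hxG ω hω).2 t

end

/-! ### The main theorem. -/

theorem proposition3p6
    (d : ℕ) (hd : 0 < d) (H : ℝ) (hH : 1 / 2 < H) (hH1 : H < 1)
    (P : Measure (FBmPath d)) [IsProbabilityMeasure P] (hP : IsFBmLaw H P)
    (A : Matrix (Fin d) (Fin d) ℝ)
    (b : ℝ → EuclideanSpace ℝ (Fin d) → EuclideanSpace ℝ (Fin d))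
    (hb : Continuous (fun p : ℝ × EuclideanSpace ℝ (Fin d) => b p.1 p.2))
    (σ : ℝ → Matrix (Fin d) (Fin d) ℝ) (hσ : Continuous σ)
    (cS mS cb mb τ : ℝ) (hcS : 0 < cS) (hmS : 0 < mS) (hcb : 0 < cb) (hmb : 0 < mb) (hτ : 0 < τ)
    (hS : ∀ t : ℝ, matOpNorm (semigroupExp A t) ≤ cS * Real.exp (-mS * t))
    (hbLip : ∀ (t : ℝ) (x y : EuclideanSpace ℝ (Fin d)), ‖b t x - b t y‖ ≤ cb * ‖x - y‖)
    (hbGrowth : ∀ (t : ℝ) (x : EuclideanSpace ℝ (Fin d)), ‖b t x‖ ≤ mb * (1 + ‖x‖))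
    (hσH : ∀ t : ℝ, MemAbsHMat H ((Iic t).indicator (fun s => semigroupExp A (t - s) * σ s)))
    (hbPer : ∀ x : EuclideanSpace ℝ (Fin d), Function.Periodic (fun t => b t x) τ)
    (hσPer : Function.Periodic σ τ)
    (hsmall : cS * cb / mS < 1) :
    ∃ X : ℝ → FBmPath d → EuclideanSpace ℝ (Fin d),
      (Measurable (Function.uncurry X) ∧ (∀ ω, Continuous (fun t => X t ω)) ∧
        IsL2Bounded P X ∧ IsThetaPeriodic P τ X ∧ IsMildSolution P A b σ X) ∧
      ∀ Y : ℝ → FBmPath d → EuclideanSpace ℝ (Fin d),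
        Measurable (Function.uncurry Y) → IsStochContinuous P Y →
        IsL2Bounded P Y → IsThetaPeriodic P τ Y → IsMildSolution P A b σ Y →
        ∀ t : ℝ, Y t =ᵐ[P] X t := by
  have h : DriftBounds A b cS mS cb mb := ⟨hb, hcS, hmS, hcb, hmb, hS, hbLip, hbGrowth⟩
  obtain ⟨Z, hZc, hZm, ⟨C, hC, hZC⟩, hZi, hZτ⟩ :=
    exists_wienerConvolution hP hH A hσ hcS hmS hτ hS hσPer
  obtain ⟨X, hXm, hXc, hX2, hXτ, hX⟩ :=
    exists_periodic_solution hP (by linarith) h hsmall hbPer hZc hZm hC hZC hZτ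
  refine ⟨X, ⟨hXm, hXc, hX2, hXτ, fun t => ⟨Z t, hZi t, hX t⟩⟩, fun Y hYm _ hY2 _ hY t => ?_⟩
  obtain ⟨D, hD, hXD⟩ := hX2
  obtain ⟨D', hD', hYD⟩ := hY2
  -- The Wiener term in the equation for Y agrees almost surely with Z t for each t, so X and Y
  -- solve the same fixed point problem.
  refine h.ae_eq_of_mild hsmall hYm hXm hD' hD hYD hXD (Z := Z) (fun t => ?_) hX t
  obtain ⟨J, hJ, hYJ⟩ := hY t
  filter_upwards [hYJ, hJ.ae_eq hP (hZi t)] with ω h1 h2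
  exact ⟨h1.1, by rw [h1.2, h2, drift]⟩
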